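/- Let $n$ and $k$ be positive integers, with $k=1$ in case $n=1$. Let $\mathsf{NM}_k(n)$ be the set of all simple graphs $G$ on the vertex set $[n]=\{1,\dots,n\}$ (including the edgeless graph) that contain no matching of size $k$, i.e. no set of $k$ pairwise disjoint edges, and let $E(G)$ be the edge set of $G$. Let $\Pi$ be the set of all set partitions $\tau=\{\tau_1,\dots,\tau_{n-2k+1}\}$ of $[n-1]$ into exactly $n-2k+1$ nonempty blocks, all of odd size (so $\Pi=\emptyset$ if $n-2k+1<0$, and for $n=k=1$ the set $\Pi$ consists of the empty partition of $[0]=\emptyset$). For odd $m\ge 1$ let $m!!=1\cdot 3\cdots m$, and let $(-1)!!=1$. Then $$\sum_{G\in \mathsf{NM}_k(n)}(-1)^{|E(G)|}=(-1)^{k-1}\sum_{\tau\in\Pi}\Bigl(\prod_{i=1}^{n-2k+1}(|\tau_i|-2)!!\Bigr)^2 .$$ In particular, for every positive integer $k$, with the sum running over all simple graphs $G$ on the vertex set $[2k]$ that have no perfect matching, $$\sum_{G}(-1)^{|E(G)|}=(-1)^{k-1}\bigl((2k-3)!!\bigr)^2 .$$ -/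

import Mathlib

open scoped Nat

/-- The graph `G` contains a matching of size `k`, i.e. with exactly `k` edges. -/
def HasMatchingOfSize {V : Type*} (G : SimpleGraph V) (k : ℕ) : Prop :=
  ∃ M : G.Subgraph, M.IsMatching ∧ M.edgeSet.ncard = k

/-- The graph `G` contains a perfect matching. -/
def HasPerfectMatching {V : Type*} (G : SimpleGraph V) : Prop :=
  ∃ M : G.Subgraph, M.IsPerfectMatching

open Classical in
/-- The graphs on `n` labelled vertices which contain no matching of size `k` (including the
edgeless graph when `k` is positive). -/
noncomputable def noMatchingGraphs (k n : ℕ) : Finset (SimpleGraph (Fin n)) :=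
  {G | ¬ HasMatchingOfSize G k}

open Classical in
/-- The graphs on `2 * k` labelled vertices which have no perfect matching. -/
noncomputable def noPerfectMatchingGraphs (k : ℕ) : Finset (SimpleGraph (Fin (2 * k))) :=
  {G | ¬ HasPerfectMatching G}

/-- The number of edges of a graph (a finite one, in all uses). -/
noncomputable def numEdges {V : Type*} (G : SimpleGraph V) : ℕ := G.edgeSet.ncard

/-- The set partitions of an `(n - 1)`-element set into exactly `n - 2k + 1` parts, all of odd
size. The number of parts is prescribed without subtraction, so there is no such partition when
`n - 2k + 1` is a negative integer. -/
def oddPartitions (n k : ℕ) : Finset (Finpartition (Finset.univ : Finset (Fin (n - 1)))) :=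
  {τ | τ.parts.card + 2 * k = n + 1 ∧ ∀ B ∈ τ.parts, Odd B.card}

/-! A signed sum over graphs vanishes whenever an edge can be toggled freely; everything rests on
finding such edges.

Remove a vertex v, leaving a vertex set s. Given the graph on s, there is no matching of size m + 1
exactly when s carries none and the neighbourhood of v avoids every vertex missed by some m-edge
matching. Summing over neighbourhoods kills all graphs except those with matching number m in which
each vertex of s is missed by a maximum matching (`signedSum_no_matching`). By Gallai's lemma
(`Parallel.trans`) these are disjoint unions of |s| - 2m factor-critical graphs. So the sum runs
over set partitions, with a factor f(|B|) for each block B, where f(m) is the signed number of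
factor-critical graphs on m vertices (`inessentialSum_insert_succ`).

To find f, take the graphs on s ∪ {v}, with |s| even and positive, for which s has a perfect
matching. Their signed sum is 0, since the edges at v are free. Let D be the set of vertices whose
removal leaves a perfect matching. If a vertex a outside D has a neighbour in D and u ≠ a is also
outside D, toggling au preserves D and the set of such vertices a, so these graphs cancel
(`signedSum_attached`). In the remaining graphs, either D induces a factor-critical graph cut off
from a perfectly matchable rest, or D omits just one vertex. This gives a recurrence
(`sum_inessentialSum_mul_perfectSum`) that determines f. The claimed values satisfy it because the
derivative of arsinh x times √(1 + x²) is 1 (`inessentialSum_one`). -/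

/-! ### Vertex sets of matchings and the exchange property. -/

/-- The finite set `X` is the vertex set of a matching whose edges lie in `E`. -/
inductive Matchable {α : Type*} [DecidableEq α] (E : Finset (Sym2 α)) : Finset α → Prop
  | empty : Matchable E ∅
  | insert_pair {x y : α} {X : Finset α} : s(x, y) ∈ E → x ≠ y → x ∉ X → y ∉ X →
      Matchable E X → Matchable E (insert x (insert y X))

namespace Matchable

variable {α : Type*} [DecidableEq α] {E E' : Finset (Sym2 α)} {X Y s : Finset α}

theorem of_erase {x y : α} (hE : s(x, y) ∈ E) (hxy : x ≠ y) (hx : x ∈ X) (hy : y ∈ X)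
    (h : Matchable E ((X.erase x).erase y)) : Matchable E X := by
  have := insert_pair hE hxy (by simp) (by simp) h
  rwa [Finset.insert_erase (by simp [hy, hxy.symm]), Finset.insert_erase hx] at this

theorem exists_partner (h : Matchable E X) {x : α} (hx : x ∈ X) :
    ∃ y ∈ X, x ≠ y ∧ s(x, y) ∈ E ∧ Matchable E ((X.erase x).erase y) := by
  induction h with
  | empty => simp at hx
  | @insert_pair a b X hab hne ha hb hX ih =>
    by_cases h1 : x = a
    · subst h1
      refine ⟨b, by simp, hne, hab, ?_⟩
      convert hX using 1
      grind
    by_cases h2 : x = b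
    · subst h2
      refine ⟨a, by simp, hne.symm, by rwa [Sym2.eq_swap], ?_⟩
      convert hX using 1
      grind
    obtain ⟨y, hy, hxy, he, hm⟩ := ih (by grind)
    refine ⟨y, by grind, hxy, he, ?_⟩
    convert insert_pair hab hne (by grind) (by grind) hm using 1
    grind

theorem even_card (h : Matchable E X) : Even X.card := by
  induction h with
  | empty => simp
  | insert_pair hab hne ha hb hX ih =>
    rw [Finset.card_insert_of_notMem (by grind), Finset.card_insert_of_notMem hb]
    grind

/-- Only edges with both ends in `X` matter; hence the edges at a vertex outside `X` can be added or
dropped. -/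
theorem mono (h : Matchable E X) (hE : ∀ x ∈ X, ∀ y ∈ X, s(x, y) ∈ E → s(x, y) ∈ E') :
    Matchable E' X := by
  induction h with
  | empty => exact empty
  | insert_pair hab hne ha hb hX ih =>
    exact insert_pair (hE _ (by simp) _ (by simp) hab) hne ha hb
      (ih fun x hx y hy => hE x (by simp [hx]) y (by simp [hy]))

theorem exists_subset_card (h : Matchable E X) {m : ℕ} (hm : 2 * m ≤ X.card) :
    ∃ Y ⊆ X, Matchable E Y ∧ Y.card = 2 * m := by
  induction h with
  | empty => exact ⟨∅, by simp, empty, by simp at hm ⊢; omega⟩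
  | @insert_pair a b X hab hne ha hb hX ih =>
    by_cases h : 2 * m ≤ X.card
    · obtain ⟨Y, hY, h1, h2⟩ := ih h
      exact ⟨Y, by grind, h1, h2⟩
    · refine ⟨_, subset_rfl, insert_pair hab hne ha hb hX, ?_⟩
      have := hX.even_card
      rw [Finset.card_insert_of_notMem (by grind), Finset.card_insert_of_notMem hb] at hm ⊢
      grind

theorem union (hX : Matchable E X) (hY : Matchable E Y) (h : Disjoint X Y) :
    Matchable E (X ∪ Y) := by
  induction hX with
  | empty => simpa
  | insert_pair hab hne ha hb hX ih =>
    simp only [Finset.disjoint_insert_left] at h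
    rw [Finset.insert_union, Finset.insert_union]
    exact insert_pair hab hne (by grind) (by grind) (ih h.2.2)

/-- The exchange property, proved by following an alternating path that starts at `t`. -/
theorem exchange {I J : Finset α} (hI : Matchable E I) (hJ : Matchable E J) {t : α} (htI : t ∈ I)
    (htJ : t ∉ J) :
    (∃ w ∈ J, w ∉ I ∧ Matchable E (insert w (I.erase t))) ∨
      ∃ w ∈ I, w ∉ J ∧ w ≠ t ∧ Matchable E (insert t (insert w J)) := by
  induction hn : I.card using Nat.strong_induction_on generalizing I J t with
  | _ n ih =>
  -- The path runs from `t` to its partner `y` in `I`, then to the partner `z` of `y` in `J`. It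
  -- stops at `y` if `y ∉ J`, which enlarges `J`, or at `z` if `z ∉ I`, which trades `t` for `z`;
  -- otherwise it continues from `z` in the smaller sets.
  obtain ⟨y, hyI, hty, hE, hI'⟩ := hI.exists_partner htI
  by_cases hyJ : y ∈ J
  · obtain ⟨z, hzJ, hyz, hE', hJ'⟩ := hJ.exists_partner hyJ
    have htz : t ≠ z := by grind
    by_cases hzI : z ∈ I
    · have hlt : ((I.erase t).erase y).card < n := by
        rw [← hn]
        exact Finset.card_lt_card ⟨by grind, fun h => by have := h htI; simp at this⟩
      rcases ih _ hlt hI' hJ' (t := z) (by grind) (by grind) rfl with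
        ⟨w, hwJ, hwI, h⟩ | ⟨w, hwI, hwJ, hwz, h⟩ <;> clear ih hI hJ hI' hJ' hlt
      · refine .inl ⟨w, by grind, by grind, ?_⟩
        convert insert_pair hE' hyz (by grind) (by grind) h using 1
        grind
      · refine .inr ⟨w, by grind, by grind, by grind, ?_⟩
        convert insert_pair hE hty (by grind) (by grind) h using 1
        grind
    · clear ih hI hJ hJ'
      refine .inl ⟨z, hzJ, hzI, ?_⟩
      convert insert_pair hE' hyz (by grind) (by grind) hI' using 1
      grind
  · exact .inr ⟨y, hyI, hyJ, hty.symm, insert_pair hE hty htJ hyJ hJ⟩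

end Matchable

/-! ### Calculus of signed sums. -/

open Classical in
/-- The sum of `(-1) ^ |E|` over the subsets `E` of `A` with the property `P`. -/
noncomputable def signedSum {β : Type*} (A : Finset β) (P : Finset β → Prop) : ℤ :=
  ∑ E ∈ A.powerset, if P E then (-1) ^ E.card else 0

section SignedSum

variable {β : Type*} {A B : Finset β} {P Q : Finset β → Prop}

theorem signedSum_congr (h : ∀ E ⊆ A, (P E ↔ Q E)) : signedSum A P = signedSum A Q := by
  rw [signedSum, signedSum]
  refine Finset.sum_congr rfl fun E hE => ?_
  have := h E (Finset.mem_powerset.1 hE)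
  by_cases hP : P E
  · rw [if_pos hP, if_pos (this.1 hP)]
  · rw [if_neg hP, if_neg fun hQ => hP (this.2 hQ)]

theorem signedSum_true (hA : A.Nonempty) : signedSum A (fun _ => True) = 0 := by
  classical
  simp only [signedSum, if_true]
  rw [Finset.sum_powerset_neg_one_pow_card, if_neg hA.ne_empty]

theorem signedSum_false : signedSum A (fun _ => False) = 0 := by simp [signedSum]

theorem signedSum_empty : signedSum ∅ P = (open Classical in if P ∅ then 1 else 0) := by
  simp [signedSum]

open Classical in
theorem signedSum_and_left (p : Prop) :
    signedSum A (fun E => p ∧ P E) = if p then signedSum A P else 0 := by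
  by_cases hp : p <;> simp [signedSum, hp]

theorem signedSum_add_not :
    signedSum A P + signedSum A (fun E => ¬ P E) = signedSum A (fun _ => True) := by
  simp only [signedSum, ← Finset.sum_add_distrib]
  refine Finset.sum_congr rfl fun E _ => ?_
  by_cases h : P E <;> simp [h]

theorem signedSum_and_add_and_not (R : Finset β → Prop) :
    signedSum A P = signedSum A (fun E => P E ∧ R E) + signedSum A (fun E => P E ∧ ¬ R E) := by
  simp only [signedSum, ← Finset.sum_add_distrib]
  refine Finset.sum_congr rfl fun E _ => ?_
  by_cases h : P E <;> by_cases h' : R E <;> simp [h, h']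

theorem signedSum_fiber {ι : Type*} (T : Finset ι) (ψ : Finset β → ι)
    (h : ∀ E ⊆ A, P E → ψ E ∈ T) :
    signedSum A P = ∑ t ∈ T, signedSum A (fun E => P E ∧ ψ E = t) := by
  classical
  simp only [signedSum]
  rw [Finset.sum_comm]
  refine Finset.sum_congr rfl fun E hE => ?_
  by_cases hP : P E
  · simp [hP, h E (Finset.mem_powerset.1 hE) hP]
  · simp [hP]

/-- Sets are paired by toggling the element `e E`. Since the toggle does not change the chosen
element, it undoes itself, and it flips the sign. -/
theorem signedSum_involution [DecidableEq β] (e : Finset β → β) (he : ∀ E ⊆ A, P E → e E ∈ A)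
    (hP : ∀ E ⊆ A, P E → P (symmDiff E {e E}))
    (hinv : ∀ E ⊆ A, P E → e (symmDiff E {e E}) = e E) : signedSum A P = 0 := by
  classical
  rw [signedSum, ← Finset.sum_filter]
  have hmem {E : Finset β} (hE : E ∈ A.powerset.filter P) : E ⊆ A ∧ P E := by simpa using hE
  refine Finset.sum_involution (fun E _ => symmDiff E {e E}) ?_ ?_ ?_ ?_
  · intro E hE
    by_cases h : e E ∈ E
    · have : symmDiff E {e E} = E.erase (e E) := by ext; simp [Finset.mem_symmDiff]; grind
      rw [this, ← Finset.card_erase_add_one h, pow_succ]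
      ring
    · have : symmDiff E {e E} = insert (e E) E := by ext; simp [Finset.mem_symmDiff]; grind
      rw [this, Finset.card_insert_of_notMem h, pow_succ]
      ring
  · intro E hE _ h
    have := congrArg (e E ∈ ·) h
    simp [Finset.mem_symmDiff] at this
  · intro E hE
    obtain ⟨h1, h2⟩ := hmem hE
    simp only [Finset.mem_filter, Finset.mem_powerset]
    refine ⟨fun x hx => ?_, hP E h1 h2⟩
    rcases Finset.mem_symmDiff.1 hx with ⟨h, _⟩ | ⟨h, _⟩
    · exact h1 h
    · rw [Finset.mem_singleton.1 h]
      exact he E h1 h2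
  · intro E hE
    obtain ⟨h1, h2⟩ := hmem hE
    simp only [hinv E h1 h2]
    exact symmDiff_symmDiff_cancel_right _ _

theorem signedSum_image {γ : Type*} {g : β → γ} [DecidableEq γ] (hg : Function.Injective g)
    {P : Finset γ → Prop} :
    signedSum (A.image g) P = signedSum A (fun E => P (E.image g)) := by
  classical
  rw [signedSum, Finset.powerset_image, Finset.sum_image]
  · simp only [signedSum, Finset.card_image_of_injective _ hg]
  · exact fun E _ F _ h => Finset.image_injective hg h

theorem signedSum_subset (h : A ⊆ B) :
    signedSum B (fun E => E ⊆ A ∧ P E) = signedSum A P := by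
  refine (Eq.trans (Finset.sum_congr rfl fun E hE => ?_)
    (Finset.sum_subset (Finset.powerset_mono.2 h) fun E _ hE => ?_)).symm
  · have hE : E ⊆ A := Finset.mem_powerset.1 hE
    by_cases hP : P E <;> simp [hE, hP]
  · have hE : ¬ E ⊆ A := fun h => hE (Finset.mem_powerset.2 h)
    simp [hE]

variable [DecidableEq β]

theorem sum_powerset_union {M : Type*} [AddCommMonoid M] (h : Disjoint A B)
    (f : Finset β → M) :
    ∑ E ∈ (A ∪ B).powerset, f E = ∑ E ∈ A.powerset, ∑ F ∈ B.powerset, f (E ∪ F) := by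
  rw [← Finset.sum_product']
  refine (Finset.sum_bij' (fun p _ => p.1 ∪ p.2) (fun E _ => (E ∩ A, E ∩ B)) ?_ ?_ ?_ ?_ ?_).symm
  · rintro ⟨E, F⟩ hp
    simp only [Finset.mem_product, Finset.mem_powerset] at hp ⊢
    exact Finset.union_subset_union hp.1 hp.2
  · intro E hE
    simp
  · rintro ⟨E, F⟩ hp
    simp only [Finset.mem_product, Finset.mem_powerset] at hp
    have h' := Finset.disjoint_left.1 h
    ext x <;> simp <;> grind
  · intro E hE
    simp only [Finset.mem_powerset] at hE
    rw [← Finset.inter_union_distrib_left, Finset.inter_eq_left.2 hE]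
  · simp

theorem signedSum_union (h : Disjoint A B) :
    signedSum (A ∪ B) P =
      ∑ E ∈ A.powerset, (-1) ^ E.card * signedSum B (fun F => P (E ∪ F)) := by
  rw [signedSum, sum_powerset_union h]
  refine Finset.sum_congr rfl fun E hE => ?_
  rw [signedSum, Finset.mul_sum]
  refine Finset.sum_congr rfl fun F hF => ?_
  rw [Finset.mem_powerset] at hE hF
  rw [Finset.card_union_of_disjoint (Finset.disjoint_of_subset_left hE
    (Finset.disjoint_of_subset_right hF h)), pow_add]
  split_ifs <;> simp

theorem signedSum_mul (h : Disjoint A B) :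
    signedSum (A ∪ B) (fun E => P (E ∩ A) ∧ Q (E ∩ B)) = signedSum A P * signedSum B Q := by
  classical
  rw [signedSum_union h]
  conv_rhs => rw [signedSum, Finset.sum_mul]
  refine Finset.sum_congr rfl fun E hE => ?_
  rw [Finset.mem_powerset] at hE
  have h' := Finset.disjoint_left.1 h
  rw [signedSum_congr (Q := fun F => P E ∧ Q F), signedSum_and_left]
  · split_ifs <;> simp
  · intro F hF
    have h1 : (E ∪ F) ∩ A = E := by ext; simp; grind
    have h2 : (E ∪ F) ∩ B = F := by ext; simp; grind
    simp only [h1, h2]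

/-- The sum is over all subsets of `A \ D`, so it vanishes unless nothing is left to choose. -/
theorem signedSum_disjoint {D : Finset β} (hD : D ⊆ A) :
    signedSum A (fun E => Disjoint E D) = if D = A then 1 else 0 := by
  rw [signedSum_congr (Q := fun E => E ⊆ A \ D ∧ True),
    signedSum_subset (P := fun _ => True) Finset.sdiff_subset]
  · split_ifs with h
    · subst h
      simp [signedSum]
    · refine signedSum_true ?_
      rw [Finset.sdiff_nonempty]
      exact fun h' => h (hD.antisymm h')
  · intro E hE
    rw [Finset.subset_sdiff]
    tauto

theorem signedSum_not_disjoint_self (hA : A.Nonempty) :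
    signedSum A (fun E => ¬ Disjoint E A) = -1 := by
  have := signedSum_add_not (A := A) (P := fun E => Disjoint E A)
  rw [signedSum_true hA, signedSum_disjoint subset_rfl] at this
  simp at this
  linarith

theorem signedSum_not_disjoint (hA : A.Nonempty) {D : Finset β} (hD : D ⊆ A) :
    signedSum A (fun E => ¬ Disjoint E D) = if D = A then -1 else 0 := by
  have := signedSum_add_not (A := A) (P := fun E => Disjoint E D)
  rw [signedSum_true hA, signedSum_disjoint hD] at this
  split_ifs at this ⊢ <;> linarith

theorem signedSum_meets_both {T : Finset β} (hT : T ⊆ A) (h1 : T.Nonempty)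
    (h2 : (A \ T).Nonempty) :
    signedSum A (fun E => ¬ Disjoint E T ∧ ¬ Disjoint E (A \ T)) = 1 := by
  have := signedSum_mul (A := T) (B := A \ T) (P := fun E => ¬ Disjoint E T)
    (Q := fun E => ¬ Disjoint E (A \ T)) Finset.disjoint_sdiff
  rw [Finset.union_sdiff_of_subset hT, signedSum_not_disjoint_self h1,
    signedSum_not_disjoint_self h2] at this
  rw [signedSum_congr (fun E hE => ?_), this]
  · rfl
  · simp [Finset.disjoint_iff_inter_eq_empty, Finset.inter_assoc]

end SignedSum

/-! ### Edge sets of complete graphs and stars. -/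

section CompleteEdges

variable {α : Type*} [DecidableEq α] {s T : Finset α} {v : α}

/-- The edges of the complete graph with vertex set `s`. -/
def completeEdges (s : Finset α) : Finset (Sym2 α) := s.sym2.filter (¬ ·.IsDiag)

@[simp] theorem mk_mem_completeEdges {x y : α} :
    s(x, y) ∈ completeEdges s ↔ (x ∈ s ∧ y ∈ s) ∧ x ≠ y := by
  simp [completeEdges]

theorem completeEdges_mono (h : T ⊆ s) : completeEdges T ⊆ completeEdges s := by
  intro e
  induction e
  simp only [mk_mem_completeEdges]
  grind

/-- The star with centre `v` and set of leaves `N`. -/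
def starEdges (v : α) (N : Finset α) : Finset (Sym2 α) := N.image (s(v, ·))

theorem mk_mem_starEdges {N : Finset α} {x y : α} :
    s(x, y) ∈ starEdges v N ↔ (x = v ∧ y ∈ N) ∨ (y = v ∧ x ∈ N) := by
  simp only [starEdges, Finset.mem_image, Sym2.eq_iff]
  grind

theorem completeEdges_insert (hv : v ∉ s) :
    completeEdges (insert v s) = completeEdges s ∪ starEdges v s := by
  ext e
  induction e
  simp only [mk_mem_completeEdges, Finset.mem_union, mk_mem_starEdges]
  grind

/-- A graph on `insert v s` is a graph on `s` together with a neighbourhood of `v`; all later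
cancellations at a vertex take place in the inner sum. -/
theorem signedSum_insert (hv : v ∉ s) (P : Finset (Sym2 α) → Prop) :
    signedSum (completeEdges (insert v s)) P = ∑ E ∈ (completeEdges s).powerset,
      (-1) ^ E.card * signedSum s (fun N => P (E ∪ starEdges v N)) := by
  rw [completeEdges_insert hv, signedSum_union]
  · refine Finset.sum_congr rfl fun E _ => ?_
    rw [starEdges, signedSum_image]
    · rfl
    · intro x y h
      have := Sym2.congr_right.1 h
      exact this
  · rw [Finset.disjoint_left]
    intro e
    induction e
    simp only [mk_mem_completeEdges, mk_mem_starEdges]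
    grind

theorem disjoint_completeEdges_sdiff :
    Disjoint (completeEdges T) (completeEdges (s \ T)) := by
  rw [Finset.disjoint_left]
  intro e
  induction e
  simp only [mk_mem_completeEdges]
  grind

theorem signedSum_split (hT : T ⊆ s) (P Q : Finset (Sym2 α) → Prop) :
    signedSum (completeEdges s) (fun E => E ⊆ completeEdges T ∪ completeEdges (s \ T) ∧
        P (E ∩ completeEdges T) ∧ Q (E ∩ completeEdges (s \ T))) =
      signedSum (completeEdges T) P * signedSum (completeEdges (s \ T)) Q := by
  rw [← signedSum_mul disjoint_completeEdges_sdiff]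
  exact signedSum_subset (P := fun E => P (E ∩ completeEdges T) ∧ Q (E ∩ completeEdges (s \ T)))
    (Finset.union_subset (completeEdges_mono hT) (completeEdges_mono Finset.sdiff_subset))

end CompleteEdges

/-! ### Matchings in a graph without edges between `T` and `s \ T`. -/

section Split

variable {α : Type*} [DecidableEq α] {E : Finset (Sym2 α)} {X Y s T : Finset α}

theorem Matchable.subset (h : Matchable E X) (hE : E ⊆ completeEdges s) : X ⊆ s := by
  induction h with
  | empty => simp
  | insert_pair hab hne ha hb hX ih =>
    have := mk_mem_completeEdges.1 (hE hab)
    grind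

theorem Matchable.inter_left (h : Matchable E X)
    (hE : E ⊆ completeEdges T ∪ completeEdges (s \ T)) :
    Matchable (E ∩ completeEdges T) (X ∩ T) := by
  induction h with
  | empty => simpa using empty
  | @insert_pair a b X hab hne ha hb hX ih =>
    rcases Finset.mem_union.1 (hE hab) with h | h
    · have h' := mk_mem_completeEdges.1 h
      rw [Finset.insert_inter_of_mem h'.1.1, Finset.insert_inter_of_mem h'.1.2]
      exact insert_pair (by simp [hab, h']) hne (by simp [ha]) (by simp [hb]) ih
    · have h' := mk_mem_completeEdges.1 h
      rwa [Finset.insert_inter_of_notMem (by grind), Finset.insert_inter_of_notMem (by grind)]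

theorem Matchable.inter_right (h : Matchable E X) (hT : T ⊆ s)
    (hE : E ⊆ completeEdges T ∪ completeEdges (s \ T)) :
    Matchable (E ∩ completeEdges (s \ T)) (X ∩ (s \ T)) :=
  h.inter_left (s := s) (by rwa [Finset.sdiff_sdiff_eq_self hT, Finset.union_comm])

theorem Matchable.of_inter (h1 : Matchable (E ∩ completeEdges T) X)
    (h2 : Matchable (E ∩ completeEdges (s \ T)) Y) : Matchable E (X ∪ Y) := by
  refine union (h1.mono fun _ _ _ _ h => (Finset.mem_inter.1 h).1)
    (h2.mono fun _ _ _ _ h => (Finset.mem_inter.1 h).1) ?_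
  have := h1.subset Finset.inter_subset_right
  have := h2.subset Finset.inter_subset_right
  rw [Finset.disjoint_left]
  grind

theorem Matchable.card_union (h1 : Matchable (E ∩ completeEdges T) X)
    (h2 : Matchable (E ∩ completeEdges (s \ T)) Y) : (X ∪ Y).card = X.card + Y.card := by
  have := h1.subset Finset.inter_subset_right
  have := h2.subset Finset.inter_subset_right
  refine Finset.card_union_of_disjoint ?_
  rw [Finset.disjoint_left]
  grind

theorem card_inter_add_card_inter (hX : X ⊆ s) :
    (X ∩ T).card + (X ∩ (s \ T)).card = X.card := by
  rw [← Finset.card_union_of_disjoint]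
  · congr 1
    ext
    simp
    grind
  · rw [Finset.disjoint_left]
    grind

end Split

/-! ### Gallai's lemma and the decomposition into factor-critical graphs. -/

section Inessential

variable {α : Type*} [DecidableEq α] {E : Finset (Sym2 α)} {X Y s T : Finset α} {j : ℕ} {v : α}

/-- The maximum matchings of the graph `E` on the vertex set `s` miss `j` vertices, and every
vertex is missed by one of them. -/
def Inessential (E : Finset (Sym2 α)) (s : Finset α) (j : ℕ) : Prop :=
  (∀ X, Matchable E X → X.card + j ≤ s.card) ∧
    ∀ w ∈ s, ∃ X, w ∉ X ∧ Matchable E X ∧ X.card + j = s.card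

theorem Inessential.exists_maximum (h : Inessential E s j) :
    ∃ X, Matchable E X ∧ X.card + j = s.card := by
  rcases s.eq_empty_or_nonempty with rfl | ⟨w, hw⟩
  · exact ⟨∅, .empty, by have := h.1 ∅ .empty; simp at this ⊢; omega⟩
  · obtain ⟨X, -, h⟩ := h.2 w hw
    exact ⟨X, h⟩

/-- Deficiency 1 is factor-criticality. Conversely, one matching that misses a single vertex makes
`s` odd, so parity alone bounds every other matching. -/
theorem inessential_one_iff (hE : E ⊆ completeEdges s) (hs : s.Nonempty) :
    Inessential E s 1 ↔ ∀ w ∈ s, Matchable E (s.erase w) := by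
  constructor
  · intro h w hw
    obtain ⟨X, hX, hm, hc⟩ := h.2 w hw
    rwa [← Finset.eq_of_subset_of_card_le (s := X) (t := s.erase w)]
    · have := hm.subset hE
      grind
    · rw [Finset.card_erase_of_mem hw]
      omega
  · intro h
    obtain ⟨w, hw⟩ := hs
    have hodd := (h w hw).even_card
    rw [Finset.card_erase_of_mem hw] at hodd
    have := Finset.card_pos.2 ⟨w, hw⟩
    refine ⟨fun X hX => ?_, fun w hw => ⟨_, by simp, h w hw, by
      rw [Finset.card_erase_of_mem hw]; omega⟩⟩
    have h1 := Finset.card_le_card (hX.subset hE)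
    have h2 := hX.even_card
    grind

/-- No maximum matching misses both `u` and `w`. -/
def Parallel (E : Finset (Sym2 α)) (s : Finset α) (j : ℕ) (u w : α) : Prop :=
  ∀ X, Matchable E X → X.card + j = s.card → u ∈ X ∨ w ∈ X

theorem Parallel.symm {u w : α} (h : Parallel E s j u w) : Parallel E s j w u :=
  fun X h1 h2 => (h X h1 h2).symm

/-- Gallai's lemma: in a graph all of whose vertices are inessential, being parallel is
transitive. -/
theorem Parallel.trans (h : Inessential E s j) {u t w : α} (ht : t ∈ s)
    (h1 : Parallel E s j u t) (h2 : Parallel E s j t w) (hne : u ≠ w) : Parallel E s j u w := by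
  intro M hM hc
  by_contra! hcon
  obtain ⟨hu, hw⟩ := hcon
  have htM : t ∈ M := by have := h1 M hM hc; tauto
  obtain ⟨N, htN, hN, hNc⟩ := h.2 t ht
  -- Either `M` trades `t` for some `y`, and the new maximum matching, missing `t`, must contain
  -- both `u` and `w`, so that `y = u = w`; or `N` can be enlarged although it is maximum.
  rcases hM.exchange hN htM htN with ⟨y, hyN, hyM, hY⟩ | ⟨y, hyM, hyN, hyt, hY⟩
  · have hcard : (insert y (M.erase t)).card + j = s.card := by
      rw [Finset.card_insert_of_notMem (by simp [hyM]), Finset.card_erase_add_one htM, hc]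
    have h3 := h1 _ hY hcard
    have h4 := h2 _ hY hcard
    have : t ∉ insert y (M.erase t) := by
      have : t ≠ y := by rintro rfl; exact hyM htM
      simp [this]
    simp only [this, or_false, false_or, Finset.mem_insert, Finset.mem_erase, hu, hw,
      and_false] at h3 h4
    exact hne (h3.trans h4.symm)
  · have := h.1 _ hY
    rw [Finset.card_insert_of_notMem (by grind), Finset.card_insert_of_notMem hyN] at this
    omega

theorem Inessential.parallel_of_mem (h : Inessential E s j) {x y : α} (hxy : s(x, y) ∈ E)
    (hne : x ≠ y) : Parallel E s j x y := by
  intro X hX hc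
  by_contra! hcon
  have := h.1 _ (Matchable.insert_pair hxy hne hcon.1 hcon.2 hX)
  rw [Finset.card_insert_of_notMem (by grind), Finset.card_insert_of_notMem hcon.2] at this
  omega

open Classical in
/-- The vertices that are equal or parallel to `v`. -/
noncomputable def parallelClass (E : Finset (Sym2 α)) (s : Finset α) (j : ℕ) (v : α) : Finset α :=
  s.filter fun w => w = v ∨ Parallel E s j v w

/-- Adjacent vertices are parallel, since an edge between two missed vertices would enlarge a
maximum matching. By transitivity no edge leaves a parallel class. -/
theorem Inessential.subset_union (h : Inessential E s j) (hE : E ⊆ completeEdges s) (v : α) :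
    E ⊆ completeEdges (parallelClass E s j v) ∪ completeEdges (s \ parallelClass E s j v) := by
  have key {x y : α} (hxy : s(x, y) ∈ E) (hx : x ∈ parallelClass E s j v) :
      y ∈ parallelClass E s j v := by
    obtain ⟨⟨hxs, hys⟩, hne⟩ := mk_mem_completeEdges.1 (hE hxy)
    have hp := h.parallel_of_mem hxy hne
    simp only [parallelClass, Finset.mem_filter] at hx ⊢
    refine ⟨hys, ?_⟩
    rcases hx.2 with rfl | hx
    · exact .inr hp
    · by_cases hyv : y = v
      · exact .inl hyv
      · exact .inr (hx.trans h hxs hp (Ne.symm hyv))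
  intro e
  induction e with
  | _ x y =>
  intro hxy
  have h1 := key hxy
  have h2 := key (x := y) (y := x) (by rwa [Sym2.eq_swap])
  have := mk_mem_completeEdges.1 (hE hxy)
  simp only [Finset.mem_union, mk_mem_completeEdges, Finset.mem_sdiff]
  tauto

/-- A maximum matching that misses `v` covers every other vertex of its class, so it has deficiency
1 on `T` and `j` outside. Deficiencies of the two sides add up, so both restrictions are maximum, as
are those of any maximum matching. -/
theorem Inessential.split (h : Inessential E s (j + 1)) (hE : E ⊆ completeEdges s) (hv : v ∈ s)
    (hT : T = parallelClass E s (j + 1) v) :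
    Inessential (E ∩ completeEdges T) T 1 ∧
      Inessential (E ∩ completeEdges (s \ T)) (s \ T) j := by
  have hsub := h.subset_union hE v
  rw [← hT] at hsub
  have hTs : T ⊆ s := by classical rw [hT]; exact Finset.filter_subset _ _
  have hvT : v ∈ T := by simp [hT, parallelClass, hv]
  have hsum : T.card + (s \ T).card = s.card := by
    rw [add_comm]
    exact Finset.card_sdiff_add_card_eq_card hTs
  obtain ⟨X, hvX, hX, hc⟩ := h.2 v hv
  have hXs := hX.subset hE
  have hXT : (X ∩ T).card + 1 = T.card := by
    have : X ∩ T = T.erase v := by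
      ext w
      simp only [Finset.mem_inter, Finset.mem_erase]
      constructor
      · rintro ⟨h1, h2⟩
        exact ⟨fun h => hvX (h ▸ h1), h2⟩
      · classical
        rintro ⟨h1, h2⟩
        refine ⟨?_, h2⟩
        rw [hT, parallelClass, Finset.mem_filter] at h2
        have := (h2.2.resolve_left h1) X hX hc
        tauto
    rw [this, Finset.card_erase_add_one hvT]
  have hXc := card_inter_add_card_inter (T := T) hXs
  have max1 : ∀ Y, Matchable (E ∩ completeEdges T) Y → Y.card + 1 ≤ T.card := by
    intro Y hY
    have h2 := hX.inter_right hTs hsub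
    have := h.1 _ (hY.of_inter h2)
    rw [hY.card_union h2] at this
    omega
  have max2 : ∀ Y, Matchable (E ∩ completeEdges (s \ T)) Y → Y.card + j ≤ (s \ T).card := by
    intro Y hY
    have h1 := hX.inter_left hsub
    have := h.1 _ (h1.of_inter hY)
    rw [h1.card_union hY] at this
    omega
  refine ⟨⟨max1, fun w hw => ?_⟩, ⟨max2, fun w hw => ?_⟩⟩
  · obtain ⟨Y, hwY, hY, hYc⟩ := h.2 w (hTs hw)
    have h1 := max1 _ (hY.inter_left hsub)
    have h2 := max2 _ (hY.inter_right hTs hsub)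
    have h3 := card_inter_add_card_inter (T := T) (hY.subset hE)
    exact ⟨Y ∩ T, by simp [hwY], hY.inter_left hsub, by omega⟩
  · obtain ⟨Y, hwY, hY, hYc⟩ := h.2 w (Finset.mem_sdiff.1 hw).1
    have h1 := max1 _ (hY.inter_left hsub)
    have h2 := max2 _ (hY.inter_right hTs hsub)
    have h3 := card_inter_add_card_inter (T := T) (hY.subset hE)
    exact ⟨Y ∩ (s \ T), by simp [hwY], hY.inter_right hTs hsub, by omega⟩

/-- Maximum matchings of the two sides combine freely, so `v` is not parallel to a vertex outside
`T`. A matching missing two vertices of `T` has deficiency at least `j + 2`, so `T` is exactly the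
class of `v`. -/
theorem Inessential.of_split (hTs : T ⊆ s) (hvT : v ∈ T)
    (hsub : E ⊆ completeEdges T ∪ completeEdges (s \ T))
    (h1 : Inessential (E ∩ completeEdges T) T 1)
    (h2 : Inessential (E ∩ completeEdges (s \ T)) (s \ T) j) :
    Inessential E s (j + 1) ∧ parallelClass E s (j + 1) v = T := by
  have hE : E ⊆ completeEdges s := hsub.trans
    (Finset.union_subset (completeEdges_mono hTs) (completeEdges_mono Finset.sdiff_subset))
  have hsum : T.card + (s \ T).card = s.card := by
    rw [add_comm]
    exact Finset.card_sdiff_add_card_eq_card hTs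
  refine ⟨⟨fun X hX => ?_, fun w hw => ?_⟩, ?_⟩
  · have h3 := h1.1 _ (hX.inter_left hsub)
    have h4 := h2.1 _ (hX.inter_right hTs hsub)
    have h5 := card_inter_add_card_inter (T := T) (hX.subset hE)
    omega
  · by_cases hwT : w ∈ T
    · obtain ⟨X, hwX, hX, hXc⟩ := h1.2 w hwT
      obtain ⟨Y, hY, hYc⟩ := h2.exists_maximum
      refine ⟨X ∪ Y, ?_, hX.of_inter hY, ?_⟩
      · have := hY.subset Finset.inter_subset_right
        grind
      · rw [hX.card_union hY]
        omega
    · obtain ⟨X, hX, hXc⟩ := h1.exists_maximum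
      obtain ⟨Y, hwY, hY, hYc⟩ := h2.2 w (by simp [hw, hwT])
      refine ⟨X ∪ Y, ?_, hX.of_inter hY, ?_⟩
      · have := hX.subset Finset.inter_subset_right
        grind
      · rw [hX.card_union hY]
        omega
  · ext w
    simp only [parallelClass, Finset.mem_filter]
    constructor
    · rintro ⟨hw, h⟩
      by_contra hwT
      obtain ⟨X, hvX, hX, hXc⟩ := h1.2 v hvT
      obtain ⟨Y, hwY, hY, hYc⟩ := h2.2 w (by simp [hw, hwT])
      have hXT := hX.subset Finset.inter_subset_right
      have hYT := hY.subset Finset.inter_subset_right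
      rcases h with rfl | h
      · exact hwT hvT
      · have := h _ (hX.of_inter hY) (by rw [hX.card_union hY]; omega)
        grind
    · intro hw
      refine ⟨hTs hw, ?_⟩
      by_contra! hcon
      obtain ⟨hne, hp⟩ := hcon
      simp only [Parallel, not_forall, not_or] at hp
      obtain ⟨X, hX, hXc, hvX, hwX⟩ := hp
      have h3 : ((T.erase v).erase w).card + 2 = T.card := by
        rw [← Finset.card_erase_add_one hvT,
          ← Finset.card_erase_add_one (show w ∈ T.erase v by simp [hne, hw])]
      have h4 : X ∩ T ⊆ (T.erase v).erase w := by grind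
      have h4 := Finset.card_le_card h4
      have h5 := card_inter_add_card_inter (T := T) (hX.subset hE)
      have h6 := h2.1 _ (hX.inter_right hTs hsub)
      omega

/-- The signed number of graphs on `s` all of whose vertices are inessential and whose maximum
matchings miss `j` vertices. -/
noncomputable def inessentialSum (s : Finset α) (j : ℕ) : ℤ :=
  signedSum (completeEdges s) fun E => Inessential E s j

theorem inessentialSum_fiber (hv : v ∈ s) (hTs : T ⊆ s) (hvT : v ∈ T) (j : ℕ) :
    signedSum (completeEdges s) (fun E => Inessential E s (j + 1) ∧
      parallelClass E s (j + 1) v = T) = inessentialSum T 1 * inessentialSum (s \ T) j := by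
  rw [inessentialSum, inessentialSum, ← signedSum_split hTs]
  refine signedSum_congr fun E hE => ⟨fun ⟨h, hT⟩ => ?_, fun ⟨h, h1, h2⟩ => ?_⟩
  · refine ⟨?_, h.split hE hv hT.symm⟩
    have := h.subset_union hE v
    rwa [hT] at this
  · exact Inessential.of_split hTs hvT h h1 h2

theorem inessentialSum_insert_succ (hv : v ∉ s) (j : ℕ) :
    inessentialSum (insert v s) (j + 1) =
      ∑ T ∈ s.powerset, inessentialSum (insert v T) 1 * inessentialSum (s \ T) j := by
  rw [inessentialSum, signedSum_fiber (s.powerset.image (insert v))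
    (fun E => parallelClass E (insert v s) (j + 1) v), Finset.sum_image]
  · refine Finset.sum_congr rfl fun T hT => ?_
    rw [Finset.mem_powerset] at hT
    rw [inessentialSum_fiber (by simp) (Finset.insert_subset_insert v hT) (by simp)]
    congr 2
    ext
    simp
    grind
  · intro T hT T' hT' h
    have hvT : v ∉ T := fun h => hv (Finset.mem_powerset.1 (Finset.mem_coe.1 hT) h)
    have hvT' : v ∉ T' := fun h => hv (Finset.mem_powerset.1 (Finset.mem_coe.1 hT') h)
    rw [← Finset.erase_insert hvT, ← Finset.erase_insert hvT', h]
  · intro E hE h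
    rw [← Finset.insert_erase (s := parallelClass E (insert v s) (j + 1) v) (a := v)]
    · refine Finset.mem_image_of_mem _ ?_
      rw [Finset.mem_powerset]
      intro x hx
      simp [parallelClass] at hx
      grind
    · simp [parallelClass]

/-- With deficiency 0 a maximum matching covers `s`, so no vertex of `s` can be missed by one. -/
theorem inessentialSum_zero : inessentialSum s 0 = if s = ∅ then 1 else 0 := by
  split_ifs with hs
  · subst hs
    simp only [inessentialSum, completeEdges, Finset.sym2_empty, Finset.filter_empty,
      signedSum_empty]
    rw [if_pos]
    exact ⟨fun X hX => by simpa using hX.subset (s := ∅) (by simp), by simp⟩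
  · rw [inessentialSum, signedSum_congr (Q := fun _ => False), signedSum_false]
    intro E hE
    refine iff_of_false (fun h => ?_) id
    obtain ⟨w, hw⟩ := Finset.nonempty_iff_ne_empty.2 hs
    obtain ⟨X, hwX, hX, hc⟩ := h.2 w hw
    have := Finset.card_lt_card (Finset.ssubset_iff_of_subset (hX.subset hE) |>.2 ⟨w, hw, hwX⟩)
    omega

theorem inessentialSum_empty_succ : inessentialSum (∅ : Finset α) (j + 1) = 0 := by
  rw [inessentialSum, signedSum_congr (Q := fun _ => False), signedSum_false]
  intro E hE
  refine iff_of_false (fun h => ?_) id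
  have := h.1 ∅ .empty
  simp at this

theorem inessentialSum_one_of_even (h : Even s.card) : inessentialSum s 1 = 0 := by
  rw [inessentialSum, signedSum_congr (Q := fun _ => False), signedSum_false]
  intro E hE
  refine iff_of_false (fun h => ?_) id
  obtain ⟨X, hX, hc⟩ := h.exists_maximum
  have := hX.even_card
  grind

end Inessential

/-! ### Removing a vertex and summing over its neighbourhood. -/

open Classical in
theorem sum_mul_signedSum_of_eq_ite {β γ : Type*} {A : Finset β} {B : Finset γ}
    {P : Finset β → Finset γ → Prop} {R : Finset β → Prop} (c : ℤ)
    (h : ∀ E ⊆ A, signedSum B (P E) = if R E then c else 0) :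
    ∑ E ∈ A.powerset, (-1) ^ E.card * signedSum B (P E) = c * signedSum A R := by
  rw [signedSum, Finset.mul_sum]
  refine Finset.sum_congr rfl fun E hE => ?_
  rw [h E (Finset.mem_powerset.1 hE)]
  by_cases hR : R E <;> simp [hR, mul_comm]

section Star

variable {α : Type*} [DecidableEq α] {E : Finset (Sym2 α)} {X N s : Finset α} {v : α}

theorem matchable_union_star_of_notMem (hv : v ∉ X) :
    Matchable (E ∪ starEdges v N) X ↔ Matchable E X := by
  refine ⟨fun h => h.mono fun x hx y hy hxy => ?_,
    fun h => h.mono fun x hx y hy hxy => Finset.mem_union_left _ hxy⟩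
  rcases Finset.mem_union.1 hxy with h | h
  · exact h
  · rw [mk_mem_starEdges] at h
    grind

theorem matchable_union_star_of_mem (hE : E ⊆ completeEdges s) (hvs : v ∉ s) (hN : N ⊆ s)
    (hv : v ∈ X) :
    Matchable (E ∪ starEdges v N) X ↔
      ∃ x ∈ N, x ∈ X ∧ Matchable E ((X.erase v).erase x) := by
  constructor
  · intro h
    obtain ⟨x, hx, hne, hvx, h'⟩ := h.exists_partner hv
    refine ⟨x, ?_, hx, (matchable_union_star_of_notMem (by simp)).1 h'⟩
    rcases Finset.mem_union.1 hvx with h | h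
    · exact absurd (mk_mem_completeEdges.1 (hE h)).1.1 hvs
    · rw [mk_mem_starEdges] at h
      grind
  · rintro ⟨x, hxN, hxX, h⟩
    refine Matchable.of_erase ?_ (by rintro rfl; exact hvs (hN hxN)) hv hxX
      ((matchable_union_star_of_notMem (by simp)).2 h)
    exact Finset.mem_union_right _ (mk_mem_starEdges.2 (.inl ⟨rfl, hxN⟩))

/-- Delete the vertex `v`: its neighbourhood can be chosen freely among the essential vertices, so
that only graphs without essential vertices contribute. -/
theorem signedSum_no_matching (hv : v ∉ s) (m : ℕ) (hs : s.Nonempty ∨ m = 0) :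
    signedSum (completeEdges (insert v s)) (fun E => ¬ ∃ X, Matchable E X ∧ X.card = 2 * (m + 1)) =
      if 2 * m ≤ s.card then inessentialSum s (s.card - 2 * m) else 0 := by
  classical
  rw [signedSum_insert hv]
  rw [sum_mul_signedSum_of_eq_ite (R := fun E => (2 * m ≤ s.card) ∧
    Inessential E s (s.card - 2 * m)) 1]
  · rw [signedSum_and_left, one_mul, inessentialSum]
    split_ifs <;> rfl
  intro E hE
  -- `D` is the set of forbidden neighbours of `v`: an edge from `v` to a vertex of `D` extends an
  -- `m`-edge matching to one with `m + 1` edges. The sum over neighbourhoods avoiding `D` is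
  -- nonzero only if `D = s`.
  set D := s.filter fun x => ∃ Y, Matchable E Y ∧ x ∉ Y ∧ Y.card = 2 * m with hD
  have hiff : (¬ ∃ X, Matchable E X ∧ X.card = 2 * (m + 1)) ∧ D = s ↔
      2 * m ≤ s.card ∧ Inessential E s (s.card - 2 * m) := by
    refine ⟨fun ⟨h1, h2⟩ => ?_, fun ⟨h1, h2⟩ => ?_⟩
    -- For empty `s` the condition `D = s` is vacuous and yields no matching of size `m`; this is
    -- where `hs` is needed.
    · have hle : 2 * m ≤ s.card := by
        rcases hs with ⟨w, hw⟩ | rfl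
        · rw [← h2, hD, Finset.mem_filter] at hw
          obtain ⟨-, Y, hY, -, hc⟩ := hw
          rw [← hc]
          exact Finset.card_le_card (hY.subset hE)
        · simp
      refine ⟨hle, fun X hX => ?_, fun w hw => ?_⟩
      · by_contra! hcon
        have := hX.even_card
        obtain ⟨Y, -, hY, hYc⟩ := hX.exists_subset_card (m := m + 1) (by grind)
        exact h1 ⟨Y, hY, hYc⟩
      · rw [← h2, hD, Finset.mem_filter] at hw
        obtain ⟨-, Y, hY, hwY, hc⟩ := hw
        exact ⟨Y, hwY, hY, by omega⟩
    · constructor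
      · rintro ⟨X, hX, hc⟩
        have := h2.1 X hX
        omega
      · refine Finset.filter_true_of_mem fun w hw => ?_
        obtain ⟨X, hwX, hX, hc⟩ := h2.2 w hw
        exact ⟨X, hX, hwX, by omega⟩
  rw [signedSum_congr (Q := fun N =>
    (¬ ∃ X, Matchable E X ∧ X.card = 2 * (m + 1)) ∧ Disjoint N D), signedSum_and_left,
    signedSum_disjoint (Finset.filter_subset _ _)]
  · by_cases h : (¬ ∃ X, Matchable E X ∧ X.card = 2 * (m + 1)) ∧ D = s
    · rw [if_pos h.1, if_pos h.2, if_pos (hiff.1 h)]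
    · rw [if_neg (mt hiff.2 h)]
      by_cases h1 : ¬ ∃ X, Matchable E X ∧ X.card = 2 * (m + 1)
      · rw [if_pos h1, if_neg fun h2 => h ⟨h1, h2⟩]
      · rw [if_neg h1]
  · intro N hN
    constructor
    · intro h
      refine ⟨fun ⟨X, hX, hc⟩ => h ⟨X, ?_, hc⟩, ?_⟩
      · exact (matchable_union_star_of_notMem fun h => hv (hX.subset hE h)).2 hX
      · rw [Finset.disjoint_left]
        intro x hxN hxD
        rw [hD, Finset.mem_filter] at hxD
        obtain ⟨hxs, Y, hY, hxY, hc⟩ := hxD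
        have hvY : v ∉ Y := fun h => hv (hY.subset hE h)
        have hvx : v ≠ x := by grind
        refine h ⟨insert v (insert x Y), Matchable.insert_pair ?_ hvx hvY hxY ?_, ?_⟩
        · exact Finset.mem_union_right _ (mk_mem_starEdges.2 (.inl ⟨rfl, hxN⟩))
        · exact (matchable_union_star_of_notMem hvY).2 hY
        · rw [Finset.card_insert_of_notMem (by simp [hvx, hvY]),
            Finset.card_insert_of_notMem hxY]
          omega
    · rintro ⟨h1, h2⟩ ⟨X, hX, hc⟩
      by_cases hvX : v ∈ X
      · obtain ⟨x, hxN, hxX, h⟩ := (matchable_union_star_of_mem hE hv hN hvX).1 hX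
        refine Finset.disjoint_left.1 h2 hxN ?_
        rw [hD, Finset.mem_filter]
        refine ⟨hN hxN, _, h, by simp, ?_⟩
        rw [Finset.card_erase_of_mem (by grind), Finset.card_erase_of_mem hvX]
        omega
      · exact h1 ⟨X, (matchable_union_star_of_notMem hvX).1 hX, hc⟩

/-- The signed number of graphs on `s` with a perfect matching. -/
noncomputable def perfectSum (s : Finset α) : ℤ :=
  signedSum (completeEdges s) fun E => Matchable E s

theorem perfectSum_empty : perfectSum (∅ : Finset α) = 1 := by
  simp only [perfectSum, completeEdges, Finset.sym2_empty, Finset.filter_empty, signedSum_empty]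
  exact if_pos .empty

theorem perfectSum_of_odd (h : Odd s.card) : perfectSum s = 0 := by
  rw [perfectSum, signedSum_congr (Q := fun _ => False), signedSum_false]
  exact fun E hE => iff_of_false (fun h' => Nat.not_even_iff_odd.2 h h'.even_card) id

/-- The neighbourhood of `v` has to meet the set of `x` for which `s.erase x` is matchable. The sum
over such neighbourhoods is -1 if that set is all of `s`, meaning that the graph is factor-critical,
and 0 otherwise. -/
theorem perfectSum_insert (hv : v ∉ s) : perfectSum (insert v s) = - inessentialSum s 1 := by
  classical
  rcases s.eq_empty_or_nonempty with rfl | hs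
  · rw [inessentialSum_empty_succ, perfectSum_of_odd (by simp), neg_zero]
  rw [perfectSum, signedSum_insert hv, sum_mul_signedSum_of_eq_ite
    (R := fun E => Inessential E s 1) (-1), inessentialSum, neg_one_mul]
  intro E hE
  rw [signedSum_congr (Q := fun N => ¬ Disjoint N (s.filter fun x => Matchable E (s.erase x))),
    signedSum_not_disjoint hs (Finset.filter_subset _ _)]
  · have hiff := (Finset.filter_eq_self (p := fun x => Matchable E (s.erase x))).trans
      (inessential_one_iff hE hs).symm
    split_ifs with h1 h2 h2
    · rfl
    · exact absurd (hiff.1 h1) h2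
    · exact absurd (hiff.2 h2) h1
    · rfl
  · intro N hN
    rw [matchable_union_star_of_mem hE hv hN (by simp), Finset.not_disjoint_iff,
      Finset.erase_insert hv]
    refine exists_congr fun x => and_congr_right fun hx => ?_
    simp [hN hx]

end Star

/-! ### Deletable vertices and the sign-reversing toggle. -/

section Toggle

variable {α : Type*} [DecidableEq α] {E : Finset (Sym2 α)} {X S : Finset α} {a u : α}

theorem Matchable.of_insert (h : Matchable (insert s(a, u) E) X) :
    Matchable E X ∨ a ∈ X ∧ u ∈ X ∧ Matchable E ((X.erase a).erase u) := by
  have key {Y : Finset α} (hY : a ∉ Y) (h : Matchable (insert s(a, u) E) Y) : Matchable E Y := by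
    refine h.mono fun x hx y hy hxy => ?_
    rcases Finset.mem_insert.1 hxy with h | h
    · rw [Sym2.eq_iff] at h
      grind
    · exact h
  by_cases ha : a ∈ X
  · obtain ⟨y, hy, hay, he, h'⟩ := h.exists_partner ha
    by_cases hyu : y = u
    · subst hyu
      exact .inr ⟨ha, hy, key (by simp) h'⟩
    · refine .inl (of_erase ?_ hay ha hy (key (by simp) h'))
      rcases Finset.mem_insert.1 he with h | h
      · rw [Sym2.eq_iff] at h
        grind
      · exact h
  · exact .inl (key ha h)

open Classical in
/-- The vertices of `S` whose deletion leaves a graph with a perfect matching. -/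
noncomputable def deletable (E : Finset (Sym2 α)) (S : Finset α) : Finset α :=
  S.filter fun w => Matchable E (S.erase w)

theorem mem_deletable {w : α} : w ∈ deletable E S ↔ w ∈ S ∧ Matchable E (S.erase w) := by
  simp [deletable]

theorem deletable_mono {E' : Finset (Sym2 α)} (h : E ⊆ E') : deletable E S ⊆ deletable E' S := by
  intro w
  simp only [mem_deletable]
  exact fun hw => ⟨hw.1, hw.2.mono fun _ _ _ _ h' => h h'⟩

/-- If `w` became deletable, the new edge would be used, so `S` without `w`, `a`, `u` is matchable
in `E`. Exchanging `w` between this set and `S.erase z`, with `z` deletable, makes one of `w`, `u`,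
`a` deletable already in `E`. -/
theorem deletable_insert (hne : (deletable E S).Nonempty) (ha : a ∈ S) (haD : a ∉ deletable E S)
    (hu : u ∈ S) (huD : u ∉ deletable E S) (hau : a ≠ u) :
    deletable (insert s(a, u) E) S = deletable E S := by
  refine (deletable_mono (Finset.subset_insert _ _)).antisymm' fun w hw => ?_
  by_contra hwD
  obtain ⟨z, hz⟩ := hne
  have hzw : z ≠ w := by rintro rfl; exact hwD hz
  have hza : z ≠ a := by rintro rfl; exact haD hz
  have hzu : z ≠ u := by rintro rfl; exact huD hz
  rw [mem_deletable] at haD huD hz hw hwD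
  rcases hw.2.of_insert with h | ⟨haw, huw, h⟩
  · exact hwD ⟨hw.1, h⟩
  · rcases hz.2.exchange h (t := w) (by simp [hzw.symm, hw.1]) (by simp) with
      ⟨y, hy, hyz, hY⟩ | ⟨y, hy, hyX, hyw, hY⟩
    · have hyz : y = z := by simp at hy hyz; tauto
      subst hyz
      refine hwD ⟨hw.1, ?_⟩
      convert hY using 1
      ext x
      simp
      grind
    · have : y = a ∨ y = u := by simp at hy hyX; tauto
      rcases this with rfl | rfl
      · refine huD ⟨hu, ?_⟩
        convert hY using 1
        ext x
        simp at haw huw ⊢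
        grind
      · refine haD ⟨ha, ?_⟩
        convert hY using 1
        ext x
        simp at haw huw ⊢
        grind

/-- If a perfect matching of `S.erase d` used `au`, replacing that edge by `ad` would make `u`
deletable. So `d` stays deletable, and `deletable_insert` applies to the smaller graph. -/
theorem deletable_erase {d : α} (hd : d ∈ deletable E S) (hda : s(a, d) ∈ E) (ha : a ∈ S)
    (haD : a ∉ deletable E S) (hu : u ∈ S) (huD : u ∉ deletable E S) (hau : a ≠ u)
    (he : s(a, u) ∈ E) : deletable (E.erase s(a, u)) S = deletable E S := by
  have hmono : deletable (E.erase s(a, u)) S ⊆ deletable E S :=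
    deletable_mono (Finset.erase_subset _ _)
  have hdu : d ≠ u := by rintro rfl; exact huD hd
  have had : a ≠ d := by rintro rfl; exact haD hd
  have hd' : d ∈ deletable (E.erase s(a, u)) S := by
    rw [mem_deletable] at hd ⊢
    refine ⟨hd.1, ?_⟩
    have h := hd.2
    rw [← Finset.insert_erase he] at h
    rcases h.of_insert with h | ⟨h1, h2, h⟩
    · exact h
    · refine absurd (mem_deletable.2 ⟨hu, ?_⟩) huD
      refine Matchable.of_erase hda had (by simp [hau, ha]) (by simp [hdu, hd.1]) ?_
      have h' := h.mono (E' := E) fun _ _ _ _ h => Finset.mem_of_mem_erase h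
      convert h' using 1
      ext x
      simp
      grind
  have := deletable_insert ⟨d, hd'⟩ ha (fun h => haD (hmono h)) hu (fun h => huD (hmono h)) hau
  rwa [Finset.insert_erase he, eq_comm] at this

theorem deletable_symmDiff {d : α} (hd : d ∈ deletable E S) (hda : s(a, d) ∈ E) (ha : a ∈ S)
    (haD : a ∉ deletable E S) (hu : u ∈ S) (huD : u ∉ deletable E S) (hau : a ≠ u) :
    deletable (symmDiff E {s(a, u)}) S = deletable E S := by
  by_cases he : s(a, u) ∈ E
  · have : symmDiff E {s(a, u)} = E.erase s(a, u) := by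
      ext
      simp [Finset.mem_symmDiff]
      grind
    rw [this, deletable_erase hd hda ha haD hu huD hau he]
  · have : symmDiff E {s(a, u)} = insert s(a, u) E := by
      ext
      simp [Finset.mem_symmDiff]
      grind
    rw [this, deletable_insert ⟨d, hd⟩ ha haD hu huD hau]

open Classical in
/-- The vertices of `S` that are not deletable but have a deletable neighbour. -/
noncomputable def attached (E : Finset (Sym2 α)) (S : Finset α) : Finset α :=
  (S \ deletable E S).filter fun a => ∃ d ∈ deletable E S, s(a, d) ∈ E

theorem mem_attached : a ∈ attached E S ↔
    (a ∈ S ∧ a ∉ deletable E S) ∧ ∃ d ∈ deletable E S, s(a, d) ∈ E := by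
  simp [attached]

/-- Being attached depends on edges with a deletable end, and the toggled edge has none. -/
theorem attached_symmDiff (haD : a ∉ deletable E S) (huD : u ∉ deletable E S)
    (h : deletable (symmDiff E {s(a, u)}) S = deletable E S) :
    attached (symmDiff E {s(a, u)}) S = attached E S := by
  ext x
  rw [mem_attached, mem_attached, h]
  refine and_congr_right fun _ => exists_congr fun d => and_congr_right fun hd => ?_
  have : s(x, d) ≠ s(a, u) := by
    rw [Ne, Sym2.eq_iff]
    grind
  simp [Finset.mem_symmDiff, this]

theorem signedSum_attached (v : α) :
    signedSum (completeEdges S) (fun E => (v ∈ deletable E S ∧ (attached E S).Nonempty) ∧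
      2 ≤ (S \ deletable E S).card) = 0 := by
  -- The edge to toggle is chosen as a function of the deletable and attached sets only. The toggle
  -- preserves both, so it selects the same edge again.
  have hg : ∀ D A : Finset α, ∃ p : α × α, (A ⊆ S \ D → A.Nonempty → 2 ≤ (S \ D).card →
      p.1 ∈ A ∧ p.2 ∈ S \ D ∧ p.1 ≠ p.2) := by
    intro D A
    by_cases h : A.Nonempty ∧ 2 ≤ (S \ D).card
    · obtain ⟨⟨a, ha⟩, hc⟩ := h
      obtain ⟨u, hu, hua⟩ := Finset.exists_mem_ne hc a
      exact ⟨(a, u), fun _ _ _ => ⟨ha, hu, hua.symm⟩⟩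
    · exact ⟨(v, v), fun _ h1 h2 => absurd ⟨h1, h2⟩ h⟩
  choose g hg using hg
  have hg' (E : Finset (Sym2 α)) (h : (v ∈ deletable E S ∧ (attached E S).Nonempty) ∧
      2 ≤ (S \ deletable E S).card) :
      ∃ a u, g (deletable E S) (attached E S) = (a, u) ∧ a ∈ attached E S ∧ u ∈ S ∧
        u ∉ deletable E S ∧ a ≠ u := by
    obtain ⟨h1, h2, h3⟩ := hg _ _ (fun x hx => by
      rw [mem_attached] at hx
      simp [hx.1]) h.1.2 h.2
    exact ⟨_, _, rfl, h1, (Finset.mem_sdiff.1 h2).1, (Finset.mem_sdiff.1 h2).2, h3⟩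
  have key (E : Finset (Sym2 α)) (h : (v ∈ deletable E S ∧ (attached E S).Nonempty) ∧
      2 ≤ (S \ deletable E S).card) :
      let e := s((g (deletable E S) (attached E S)).1, (g (deletable E S) (attached E S)).2)
      deletable (symmDiff E {e}) S = deletable E S ∧ attached (symmDiff E {e}) S = attached E S := by
    obtain ⟨a, u, hau, ha, hu, huD, hne⟩ := hg' E h
    rw [mem_attached] at ha
    obtain ⟨⟨haS, haD⟩, d, hd, had⟩ := ha
    have := deletable_symmDiff hd had haS haD hu huD hne
    simp only [hau]
    exact ⟨this, attached_symmDiff haD huD this⟩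
  refine signedSum_involution (fun E => s((g (deletable E S) (attached E S)).1,
    (g (deletable E S) (attached E S)).2)) ?_ ?_ ?_
  · intro E hE h
    obtain ⟨a, u, hau, ha, hu, huD, hne⟩ := hg' E h
    rw [mem_attached] at ha
    simp only [hau]
    exact mk_mem_completeEdges.2 ⟨⟨ha.1.1, hu⟩, hne⟩
  · intro E hE h
    rw [(key E h).1, (key E h).2]
    exact h
  · intro E hE h
    rw [(key E h).1, (key E h).2]

end Toggle

/-! ### The recurrence from graphs in which a marked vertex is deletable. -/

section MarkedVertex

variable {α : Type*} [DecidableEq α] {E : Finset (Sym2 α)} {X N S T s : Finset α} {a v w : α}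

/-- Without attached vertices no edge joins `T` to the rest, so perfect matchings of `S.erase w` for
`w ∈ T` restrict to both sides. -/
theorem deletable_split (hE : E ⊆ completeEdges S) (hT : deletable E S = T) (hv : v ∈ T)
    (hA : ¬ (attached E S).Nonempty) :
    E ⊆ completeEdges T ∪ completeEdges (S \ T) ∧ Inessential (E ∩ completeEdges T) T 1 ∧
      Matchable (E ∩ completeEdges (S \ T)) (S \ T) := by
  have hTS : T ⊆ S := by
    intro x hx
    rw [← hT, mem_deletable] at hx
    exact hx.1
  have key {x y : α} (hxy : s(x, y) ∈ E) (hx : x ∈ S) (hy : y ∈ T) : x ∈ T := by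
    by_contra h
    rw [← hT] at h hy
    exact hA ⟨x, mem_attached.2 ⟨⟨hx, h⟩, y, hy, hxy⟩⟩
  have hsub : E ⊆ completeEdges T ∪ completeEdges (S \ T) := by
    intro e
    induction e with
    | _ x y =>
    intro hxy
    have h := mk_mem_completeEdges.1 (hE hxy)
    have h1 := key hxy h.1.1
    have h2 := key (x := y) (y := x) (by rwa [Sym2.eq_swap]) h.1.2
    simp only [Finset.mem_union, mk_mem_completeEdges, Finset.mem_sdiff]
    tauto
  refine ⟨hsub, (inessential_one_iff Finset.inter_subset_right ⟨v, hv⟩).2 fun w hw => ?_, ?_⟩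
  · have hw' := hw
    rw [← hT, mem_deletable] at hw'
    convert hw'.2.inter_left hsub using 1
    ext
    simp
    grind
  · have hv' := hv
    rw [← hT, mem_deletable] at hv'
    convert hv'.2.inter_right hTS hsub using 1
    ext
    simp
    grind

theorem deletable_of_split (hTS : T ⊆ S) (hv : v ∈ T)
    (hsub : E ⊆ completeEdges T ∪ completeEdges (S \ T))
    (h1 : Inessential (E ∩ completeEdges T) T 1)
    (h2 : Matchable (E ∩ completeEdges (S \ T)) (S \ T)) :
    deletable E S = T ∧ ¬ (attached E S).Nonempty := by
  have hT : deletable E S = T := by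
    ext w
    rw [mem_deletable]
    constructor
    · rintro ⟨hw, h⟩
      by_contra hwT
      have := h1.1 _ (h.inter_left hsub)
      rw [show S.erase w ∩ T = T by ext; simp; grind] at this
      omega
    · intro hw
      refine ⟨hTS hw, ?_⟩
      convert ((inessential_one_iff Finset.inter_subset_right ⟨v, hv⟩).1 h1 w hw).of_inter h2
        using 1
      ext
      simp
      grind
  refine ⟨hT, ?_⟩
  rintro ⟨x, hx⟩
  obtain ⟨⟨hxS, hxD⟩, d, hd, hxd⟩ := mem_attached.1 hx
  rw [hT] at hxD hd
  have := hsub hxd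
  simp only [Finset.mem_union, mk_mem_completeEdges, Finset.mem_sdiff] at this
  tauto

theorem signedSum_not_attached (hv : v ∉ s) :
    signedSum (completeEdges (insert v s)) (fun E => v ∈ deletable E (insert v s) ∧
      ¬ (attached E (insert v s)).Nonempty) =
      ∑ T ∈ s.powerset, inessentialSum (insert v T) 1 * perfectSum (s \ T) := by
  rw [signedSum_fiber (s.powerset.image (insert v)) (fun E => deletable E (insert v s)),
    Finset.sum_image]
  · refine Finset.sum_congr rfl fun T hT => ?_
    rw [Finset.mem_powerset] at hT
    have hT' : insert v T ⊆ insert v s := Finset.insert_subset_insert v hT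
    rw [show s \ T = insert v s \ insert v T by ext; simp; grind, inessentialSum, perfectSum,
      ← signedSum_split hT']
    refine signedSum_congr fun E hE => ⟨fun ⟨h, hD⟩ => ?_, fun ⟨h, h1, h2⟩ => ?_⟩
    · exact deletable_split hE hD (Finset.mem_insert_self v T) h.2
    · obtain ⟨h3, h4⟩ := deletable_of_split hT' (Finset.mem_insert_self v T) h h1 h2
      exact ⟨⟨by simp [h3], h4⟩, h3⟩
  · intro T hT T' hT' h
    have hvT : v ∉ T := fun h => hv (Finset.mem_powerset.1 (Finset.mem_coe.1 hT) h)
    have hvT' : v ∉ T' := fun h => hv (Finset.mem_powerset.1 (Finset.mem_coe.1 hT') h)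
    rw [← Finset.erase_insert hvT, ← Finset.erase_insert hvT', h]
  · intro E hE h
    rw [← Finset.insert_erase h.1]
    refine Finset.mem_image_of_mem _ ?_
    rw [Finset.mem_powerset]
    intro x hx
    rw [Finset.mem_erase, mem_deletable] at hx
    grind

/-- That `a` is not deletable means that `s` is not matchable; that `w` is deletable means that `a`
can be matched to some `x ∈ N`. -/
theorem deletable_insert_eq_iff (ha : a ∉ s) (hE : E ⊆ completeEdges s) (hN : N ⊆ s) :
    deletable (E ∪ starEdges a N) (insert a s) = s ↔
      ¬ Matchable E s ∧ ∀ w ∈ s, ∃ x ∈ N, x ≠ w ∧ Matchable E ((s.erase w).erase x) := by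
  have key {w : α} (hw : w ∈ s) : Matchable (E ∪ starEdges a N) ((insert a s).erase w) ↔
      ∃ x ∈ N, x ≠ w ∧ Matchable E ((s.erase w).erase x) := by
    have haw : a ≠ w := by rintro rfl; exact ha hw
    rw [matchable_union_star_of_mem hE ha hN (by simp [haw])]
    refine exists_congr fun x => and_congr_right fun hx => ?_
    rw [show ((insert a s).erase w).erase a = s.erase w by ext; simp; grind]
    refine and_congr_left fun _ => ?_
    simp [hN hx]
  rw [Finset.ext_iff]
  constructor
  · intro h
    constructor
    · intro hm
      refine ha ((h a).1 (mem_deletable.2 ⟨by simp, ?_⟩))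
      rw [Finset.erase_insert ha]
      exact (matchable_union_star_of_notMem ha).2 hm
    · exact fun w hw => (key hw).1 (mem_deletable.1 ((h w).2 hw)).2
  · rintro ⟨h1, h2⟩ w
    rw [mem_deletable]
    constructor
    · rintro ⟨hw, hm⟩
      rcases Finset.mem_insert.1 hw with rfl | hw
      · rw [Finset.erase_insert ha, matchable_union_star_of_notMem ha] at hm
        exact absurd hm h1
      · exact hw
    · exact fun hw => ⟨by simp [hw], (key hw).2 (h2 w hw)⟩

theorem inessential_two_of_forall (hs : Even s.card) (hE : E ⊆ completeEdges s) (hN : N ⊆ s)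
    (h : ¬ Matchable E s ∧ ∀ w ∈ s, ∃ x ∈ N, x ≠ w ∧ Matchable E ((s.erase w).erase x)) :
    Inessential E s 2 := by
  refine ⟨fun X hX => ?_, fun w hw => ?_⟩
  · have h1 := Finset.card_le_card (hX.subset hE)
    have h2 := hX.even_card
    have h3 : X.card ≠ s.card := fun h3 =>
      h.1 (Finset.eq_of_subset_of_card_le (hX.subset hE) h3.ge ▸ hX)
    grind
  · obtain ⟨x, hx, hxw, hm⟩ := h.2 w hw
    refine ⟨_, by simp, hm, ?_⟩
    have h1 : x ∈ s.erase w := by simp [hxw, hN hx]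
    have h2 := Finset.card_erase_add_one h1
    have h3 := Finset.card_erase_add_one hw
    omega

/-- Both sides are factor-critical, hence odd: the two removed vertices must lie on different sides.
-/
theorem Inessential.matchable_erase_erase_iff {x : α} (hT : T ⊆ s)
    (hsub : E ⊆ completeEdges T ∪ completeEdges (s \ T))
    (h1 : Inessential (E ∩ completeEdges T) T 1)
    (h2 : Inessential (E ∩ completeEdges (s \ T)) (s \ T) 1) (hw : w ∈ T) (hx : x ∈ s) :
    Matchable E ((s.erase w).erase x) ↔ x ∉ T := by
  constructor
  · intro h hxT
    have h3 := h2.1 _ (h.inter_right hT hsub)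
    rw [show (s.erase w).erase x ∩ (s \ T) = s \ T by ext; simp; grind] at h3
    omega
  · intro hxT
    have hxT' : x ∈ s \ T := by simp [hx, hxT]
    convert ((inessential_one_iff Finset.inter_subset_right ⟨w, hw⟩).1 h1 w hw).of_inter
      ((inessential_one_iff Finset.inter_subset_right ⟨x, hxT'⟩).1 h2 x hxT') using 1
    ext
    simp
    grind

theorem Inessential.forall_exists_iff (hT : T ⊆ s) (hTne : T.Nonempty) (hTne' : (s \ T).Nonempty)
    (hsub : E ⊆ completeEdges T ∪ completeEdges (s \ T)) (hN : N ⊆ s)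
    (h1 : Inessential (E ∩ completeEdges T) T 1)
    (h2 : Inessential (E ∩ completeEdges (s \ T)) (s \ T) 1) :
    (∀ w ∈ s, ∃ x ∈ N, x ≠ w ∧ Matchable E ((s.erase w).erase x)) ↔
      ¬ Disjoint N T ∧ ¬ Disjoint N (s \ T) := by
  have hdd : s \ (s \ T) = T := Finset.sdiff_sdiff_eq_self hT
  have key {w x : α} (hw : w ∈ T) (hx : x ∈ s) :=
    h1.matchable_erase_erase_iff hT hsub h2 hw hx
  have key' {w x : α} (hw : w ∈ s \ T) (hx : x ∈ s) :=
    h2.matchable_erase_erase_iff (s := s) Finset.sdiff_subset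
      (by rwa [hdd, Finset.union_comm]) (by rwa [hdd]) hw hx
  simp only [Finset.not_disjoint_iff]
  constructor
  · intro h
    obtain ⟨t, ht⟩ := hTne
    obtain ⟨t', ht'⟩ := hTne'
    obtain ⟨x, hxN, hxt, hx⟩ := h t (hT ht)
    obtain ⟨y, hyN, hyt, hy⟩ := h t' (Finset.mem_sdiff.1 ht').1
    rw [key ht (hN hxN)] at hx
    rw [key' ht' (hN hyN)] at hy
    have := hN hxN
    have := hN hyN
    grind
  · rintro ⟨⟨x, hxN, hxT⟩, y, hyN, hyT⟩ w hw
    by_cases hwT : w ∈ T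
    · have hyw : y ≠ w := by grind
      exact ⟨y, hyN, hyw, (key hwT (hN hyN)).2 (by grind)⟩
    · have hxw : x ≠ w := by grind
      exact ⟨x, hxN, hxw, (key' (by simp [hw, hwT]) (hN hxN)).2 (by simp [hxT])⟩

/-- The graph on `s` must consist of two factor-critical parts, and the neighbourhood of `a` must
meet both, which contributes (-1)(-1) = 1. -/
theorem signedSum_deletable_insert_eq (ha : a ∉ s) (hs : Even s.card) (hv : v ∈ s) :
    signedSum (completeEdges (insert a s)) (fun E => deletable E (insert a s) = s) =
      inessentialSum s 2 := by
  classical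
  rw [signedSum_insert ha, sum_mul_signedSum_of_eq_ite (R := fun E => Inessential E s 2) 1,
    one_mul, inessentialSum]
  intro E hE
  rw [signedSum_congr fun N hN => deletable_insert_eq_iff ha hE hN]
  split_ifs with h
  · have hsub := h.subset_union hE v
    have h12 := h.split hE hv rfl
    set T := parallelClass E s (1 + 1) v
    have hT : T ⊆ s := Finset.filter_subset _ _
    have hvT : v ∈ T := by simp [T, parallelClass, hv]
    have hTc : Odd T.card := by
      obtain ⟨X, hX, hc⟩ := h12.1.exists_maximum
      have := hX.even_card
      grind
    have hTne' : (s \ T).Nonempty := by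
      rw [Finset.sdiff_nonempty]
      intro hle
      rw [hT.antisymm hle] at hTc
      exact Nat.not_even_iff_odd.2 hTc hs
    rw [← signedSum_meets_both hT ⟨v, hvT⟩ hTne']
    refine signedSum_congr fun N hN => ?_
    rw [h12.1.forall_exists_iff hT ⟨v, hvT⟩ hTne' hsub hN h12.2]
    refine and_iff_right fun hm => ?_
    have := h.1 _ hm
    omega
  · rw [signedSum_congr (Q := fun _ => False), signedSum_false]
    exact fun N hN => iff_of_false (fun h' => h (inessential_two_of_forall hs hE hN h')) id

theorem signedSum_attached_one (hv : v ∉ s) (hs : Even s.card) :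
    signedSum (completeEdges (insert v s)) (fun E => (v ∈ deletable E (insert v s) ∧
      (attached E (insert v s)).Nonempty) ∧ ¬ 2 ≤ (insert v s \ deletable E (insert v s)).card) =
      ∑ a ∈ s, inessentialSum ((insert v s).erase a) 2 := by
  rw [signedSum_fiber (s.image (insert v s).erase) (fun E => deletable E (insert v s)),
    Finset.sum_image]
  · refine Finset.sum_congr rfl fun a ha => ?_
    have hav : v ≠ a := by rintro rfl; exact hv ha
    have hins : insert a ((insert v s).erase a) = insert v s := Finset.insert_erase (by simp [ha])
    rw [← signedSum_deletable_insert_eq (v := v) (Finset.notMem_erase a _) ?_ (by simp [hav]), hins]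
    · refine signedSum_congr fun E hE => and_iff_right_of_imp fun hD => ?_
      have hvD : v ∈ (insert v s).erase a := by simp [hav]
      have hsd : insert v s \ (insert v s).erase a = {a} := by
        ext x
        simp
        grind
      refine ⟨⟨by rwa [hD], ?_⟩, by simp [hD, hsd]⟩
      -- Without attached vertices the single non-deletable vertex would form a matchable set of odd
      -- size.
      by_contra hA
      have := (deletable_split hE hD hvD hA).2.2.even_card
      simp [hsd] at this
    · rw [Finset.card_erase_of_mem (by simp [ha]), Finset.card_insert_of_notMem hv]
      simpa using hs
  · exact (Finset.erase_injOn _).mono (by intro x; simp +contextual)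
  · rintro E hE ⟨⟨hvD, x, hx⟩, hc⟩
    rw [mem_attached] at hx
    have hxs : x ∈ s := by
      have : x ≠ v := by rintro rfl; exact hx.1.2 hvD
      have := hx.1.1
      grind
    refine Finset.mem_image.2 ⟨x, hxs, ?_⟩
    have h1 : insert v s \ deletable E (insert v s) = {x} := by
      refine (Finset.eq_of_subset_of_card_le (by simp [hx.1]) ?_).symm
      simp
      omega
    ext y
    have h2 := congrArg (y ∈ ·) h1
    have h3 : y ∈ deletable E (insert v s) → y ∈ insert v s := fun h => (mem_deletable.1 h).1
    simp only [Finset.mem_sdiff, Finset.mem_singleton, eq_iff_iff] at h2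
    rw [Finset.mem_erase]
    have h4 := hx.1.1
    constructor
    · tauto
    · intro hy
      refine ⟨?_, h3 hy⟩
      rintro rfl
      exact hx.1.2 hy

/-- The graphs for which the deletion of `v` leaves a graph with a perfect matching, sorted by
their deletable vertices. -/
theorem sum_inessentialSum_mul_perfectSum (hv : v ∉ s) (hs : Even s.card) (hne : s.Nonempty) :
    ∑ T ∈ s.powerset, inessentialSum (insert v T) 1 * perfectSum (s \ T) +
      ∑ a ∈ s, inessentialSum ((insert v s).erase a) 2 = 0 := by
  -- Whether `v` is deletable does not depend on the edges at `v`, so the sum over neighbourhoods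
  -- vanishes.
  have h0 : signedSum (completeEdges (insert v s)) (fun E => v ∈ deletable E (insert v s)) = 0 := by
    classical
    rw [signedSum_insert hv]
    refine Finset.sum_eq_zero fun E hE => ?_
    rw [signedSum_congr (Q := fun _ => Matchable E s ∧ True), signedSum_and_left,
      signedSum_true hne]
    · simp
    · intro N hN
      simp [mem_deletable, Finset.erase_insert hv, matchable_union_star_of_notMem hv]
  rw [signedSum_and_add_and_not fun E => (attached E (insert v s)).Nonempty,
    signedSum_and_add_and_not (fun E => 2 ≤ (insert v s \ deletable E (insert v s)).card),
    signedSum_attached, signedSum_attached_one hv hs, signedSum_not_attached hv] at h0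
  linarith

end MarkedVertex

/-! ### Factor-critical numbers and their generating function. -/

/-- The signed number of factor-critical graphs on `m` labelled vertices. -/
def factorCriticalNumber (m : ℕ) : ℤ :=
  if Odd m then (-1) ^ ((m - 1) / 2) * ((m - 2)‼ : ℕ) ^ 2 else 0

theorem factorCriticalNumber_of_even {m : ℕ} (h : Even m) : factorCriticalNumber m = 0 :=
  if_neg (Nat.not_odd_iff_even.2 h)

theorem factorCriticalNumber_one : factorCriticalNumber 1 = 1 := by
  simp [factorCriticalNumber]

theorem factorCriticalNumber_add_two (m : ℕ) :
    factorCriticalNumber (m + 2) = - (m : ℤ) ^ 2 * factorCriticalNumber m := by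
  rcases Nat.even_or_odd m with h | h
  · rw [factorCriticalNumber_of_even h, factorCriticalNumber_of_even (by simpa [Nat.even_add]),
      mul_zero]
  · rw [factorCriticalNumber, factorCriticalNumber, if_pos h, if_pos (by simpa [Nat.odd_add])]
    obtain ⟨k, rfl⟩ := h
    rw [show (2 * k + 1 + 2 - 1) / 2 = k + 1 by omega, show (2 * k + 1 - 1) / 2 = k by omega,
      show 2 * k + 1 + 2 - 2 = 2 * k + 1 by omega]
    -- For `k = 0` the subtraction truncates to 0, and `0‼ = 1` agrees with the convention (-1)!! =
    -- 1.
    have : (2 * k + 1)‼ = (2 * k + 1) * (2 * k + 1 - 2)‼ := by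
      rcases k with _ | k
      · simp
      · exact Nat.doubleFactorial_add_two (2 * k + 1)
    rw [this]
    push_cast
    ring

/-- The exponential coefficients of `√(1 + x²)`. -/
def sqrtCoeff : ℕ → ℤ
  | 0 => 1
  | l + 1 => l * factorCriticalNumber l

section PowerSeries

open PowerSeries

/-- The derivative of the inverse hyperbolic sine. -/
noncomputable def arsinhDeriv : ℚ⟦X⟧ := mk fun n => (factorCriticalNumber (n + 1) : ℚ) / n !

/-- The power series of `√(1 + x²)`. -/
noncomputable def sqrtSeries : ℚ⟦X⟧ := mk fun n => (sqrtCoeff n : ℚ) / n !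

theorem sqrtSeries_eq : sqrtSeries = (1 + X ^ 2) * arsinhDeriv := by
  ext n
  rw [add_mul, one_mul, map_add, coeff_X_pow_mul']
  rcases n with _ | _ | n
  · simp [sqrtSeries, arsinhDeriv, sqrtCoeff, factorCriticalNumber_one]
  · simp [sqrtSeries, arsinhDeriv, sqrtCoeff, factorCriticalNumber_of_even]
  · simp only [sqrtSeries, arsinhDeriv, coeff_mk, sqrtCoeff, if_pos (Nat.le_add_left 2 n),
      factorCriticalNumber_add_two (n + 1), Nat.factorial_succ]
    push_cast
    have := Nat.factorial_ne_zero n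
    field_simp
    ring

theorem derivative_sqrtSeries : d⁄dX ℚ sqrtSeries = X * arsinhDeriv := by
  ext n
  rcases n with _ | n
  · simp [coeff_derivative, sqrtSeries, sqrtCoeff]
  · simp only [coeff_derivative, coeff_succ_X_mul, sqrtSeries, arsinhDeriv, coeff_mk, sqrtCoeff,
      Nat.factorial_succ]
    push_cast
    have := Nat.factorial_ne_zero n
    field_simp

theorem derivative_arsinhDeriv :
    (1 + X ^ 2) * d⁄dX ℚ arsinhDeriv = - (X * arsinhDeriv) := by
  ext n
  rw [add_mul, one_mul, map_add, coeff_X_pow_mul', map_neg]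
  rcases n with _ | _ | n
  · simp [coeff_derivative, arsinhDeriv, factorCriticalNumber_of_even]
  · simp only [coeff_derivative, coeff_succ_X_mul, arsinhDeriv, coeff_mk,
      factorCriticalNumber_add_two, factorCriticalNumber_one]
    norm_num [factorCriticalNumber_one, Nat.factorial]
  · simp only [coeff_derivative, coeff_succ_X_mul, arsinhDeriv, coeff_mk,
      if_pos (Nat.le_add_left 2 n), factorCriticalNumber_add_two (n + 2),
      Nat.factorial_succ]
    push_cast
    have := Nat.factorial_ne_zero n
    field_simp
    ring

/-- With A for `arsinhDeriv`, the product has derivative A'(1 + x²)A + A·xA = -xA² + xA² = 0, and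
its constant term is 1. -/
theorem arsinhDeriv_mul_sqrtSeries : arsinhDeriv * sqrtSeries = 1 := by
  refine derivative.ext ?_ ?_
  · rw [Derivation.leibniz, derivative_sqrtSeries, smul_eq_mul, smul_eq_mul, sqrtSeries_eq,
      mul_right_comm, derivative_arsinhDeriv]
    simp
    ring
  · have h1 : constantCoeff arsinhDeriv = 1 := by
      rw [← coeff_zero_eq_constantCoeff_apply, arsinhDeriv, coeff_mk]
      simp [factorCriticalNumber_one]
    have h2 : constantCoeff sqrtSeries = 1 := by
      rw [← coeff_zero_eq_constantCoeff_apply, sqrtSeries, coeff_mk]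
      simp [sqrtCoeff]
    simp [h1, h2]

theorem sum_choose_mul_sqrtCoeff {m : ℕ} (hm : m ≠ 0) :
    ∑ i ∈ Finset.range (m + 1),
      (m.choose i : ℤ) * (factorCriticalNumber (i + 1) * sqrtCoeff (m - i)) = 0 := by
  have h := congrArg (coeff m) arsinhDeriv_mul_sqrtSeries
  rw [coeff_mul, coeff_one, if_neg hm, Finset.Nat.sum_antidiagonal_eq_sum_range_succ_mk] at h
  have : ((∑ i ∈ Finset.range (m + 1),
      (m.choose i : ℤ) * (factorCriticalNumber (i + 1) * sqrtCoeff (m - i)) : ℤ) : ℚ) = 0 := by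
    rw [← mul_zero (m ! : ℚ), ← h, Finset.mul_sum, Int.cast_sum]
    refine Finset.sum_congr rfl fun i hi => ?_
    have hi : i ≤ m := Nat.lt_succ_iff.1 (Finset.mem_range.1 hi)
    simp only [arsinhDeriv, sqrtSeries, coeff_mk]
    rw [← Nat.choose_mul_factorial_mul_factorial hi]
    have h1 := Nat.factorial_ne_zero i
    have h2 := Nat.factorial_ne_zero (m - i)
    push_cast
    field_simp
  exact_mod_cast this

end PowerSeries

/-! ### Evaluation of the signed sums. -/

/-- The sum over the partitions of an `m`-element set into `j` blocks of the product of
`factorCriticalNumber` over the block sizes. -/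
def blockNumber : ℕ → ℕ → ℤ
  | 0, m => if m = 0 then 1 else 0
  | _ + 1, 0 => 0
  | j + 1, m + 1 => ∑ i ∈ Finset.range (m + 1),
      m.choose i * (factorCriticalNumber (i + 1) * blockNumber j (m - i))

section

variable {α : Type*} [DecidableEq α] {s : Finset α} {v : α}

theorem inessentialSum_singleton : inessentialSum {v} 1 = 1 := by
  have h : completeEdges {v} = ∅ := by
    ext e
    induction e
    simp
    grind
  rw [inessentialSum, h, signedSum_empty, if_pos]
  rw [inessential_one_iff (by simp) (by simp)]
  simp [Matchable.empty]

theorem inessentialSum_two_of_forall {n : ℕ}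
    (ih : ∀ t : Finset α, t.card < n → inessentialSum t 1 = factorCriticalNumber t.card)
    {m : ℕ} (hs : s.card = m + 1) (hn : m + 1 < n) :
    inessentialSum s 2 = ∑ i ∈ Finset.range (m + 1),
      m.choose i * (factorCriticalNumber (i + 1) * factorCriticalNumber (m - i)) := by
  obtain ⟨v, s, hv, rfl, hm⟩ := Finset.card_eq_succ.1 hs
  rw [inessentialSum_insert_succ hv 1, ← hm]
  simp only [← nsmul_eq_mul]
  rw [← Finset.sum_powerset_apply_card (f := fun i =>
    factorCriticalNumber (i + 1) * factorCriticalNumber (s.card - i))]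
  refine Finset.sum_congr rfl fun T hT => ?_
  rw [Finset.mem_powerset] at hT
  have hc := Finset.card_le_card hT
  have hvT : v ∉ T := fun h => hv (hT h)
  have hd := Finset.card_sdiff_of_subset hT
  rw [ih _ (by rw [Finset.card_insert_of_notMem hvT]; omega), ih _ (by omega),
    Finset.card_insert_of_notMem hvT, hd]

theorem perfectSum_of_forall {n : ℕ}
    (ih : ∀ t : Finset α, t.card < n → inessentialSum t 1 = factorCriticalNumber t.card)
    {m : ℕ} (hs : s.card = m + 1) (hn : m < n) :
    perfectSum s = - factorCriticalNumber m := by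
  obtain ⟨v, s, hv, rfl, hm⟩ := Finset.card_eq_succ.1 hs
  rw [perfectSum_insert hv, ih _ (by omega), hm]

/-- In the recurrence the term `T = s` is the unknown with coefficient 1, and all other terms
involve smaller sets. Subtracting `sum_choose_mul_sqrtCoeff`, the same recurrence for the closed
form, isolates it. -/
theorem inessentialSum_one (s : Finset α) :
    inessentialSum s 1 = factorCriticalNumber s.card := by
  induction hn : s.card using Nat.strong_induction_on generalizing s with
  | _ n ih =>
  replace ih : ∀ t : Finset α, t.card < n → inessentialSum t 1 = factorCriticalNumber t.card :=
    fun t ht => ih _ ht t rfl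
  rcases Nat.even_or_odd n with h | ⟨k, rfl⟩
  · rw [inessentialSum_one_of_even (hn ▸ h), factorCriticalNumber_of_even h]
  rcases k with _ | k
  · obtain ⟨v, rfl⟩ := Finset.card_eq_one.1 hn
    rw [inessentialSum_singleton]
    exact factorCriticalNumber_one.symm
  obtain ⟨v, s, hv, rfl, hm⟩ := Finset.card_eq_succ.1 hn
  set m := 2 * (k + 1) with hmk
  have key := sum_inessentialSum_mul_perfectSum hv (by rw [hm]; simp [hmk])
    (Finset.card_pos.1 (by omega))
  have h2 : ∑ a ∈ s, inessentialSum ((insert v s).erase a) 2 =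
      m * ∑ i ∈ Finset.range m, ((m - 1).choose i : ℤ) *
        (factorCriticalNumber (i + 1) * factorCriticalNumber (m - 1 - i)) := by
    rw [← hm, ← nsmul_eq_mul, ← Finset.sum_const, hm]
    refine Finset.sum_congr rfl fun a ha => ?_
    have : (m - 1) + 1 = m := by omega
    rw [inessentialSum_two_of_forall ih (m := m - 1) _ (by omega), this]
    rw [Finset.card_erase_of_mem (by simp [ha]), hn]
    omega
  -- The signed number of perfectly matchable graphs on `l` vertices, as known by induction.
  let p : ℕ → ℤ := fun l => if l = 0 then 1 else - factorCriticalNumber (l - 1)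
  have h1 : ∑ T ∈ s.powerset, inessentialSum (insert v T) 1 * perfectSum (s \ T) =
      inessentialSum (insert v s) 1 - factorCriticalNumber (m + 1) +
        ∑ i ∈ Finset.range (m + 1),
          (m.choose i : ℤ) * (factorCriticalNumber (i + 1) * p (m - i)) := by
    simp only [← nsmul_eq_mul]
    rw [← hm, ← Finset.sum_powerset_apply_card (f := fun i =>
      factorCriticalNumber (i + 1) * p (s.card - i)), hm, ← sub_eq_iff_eq_add,
      ← Finset.sum_sub_distrib]
    rw [Finset.sum_eq_single s]
    · simp [perfectSum_empty, p, hm]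
    · intro T hT hTs
      rw [Finset.mem_powerset] at hT
      have hc := Finset.card_lt_card (hT.ssubset_of_ne hTs)
      have hvT : v ∉ T := fun h => hv (hT h)
      have hd := Finset.card_sdiff_of_subset hT
      rw [ih _ (by rw [Finset.card_insert_of_notMem hvT]; omega),
        Finset.card_insert_of_notMem hvT,
        perfectSum_of_forall ih (m := m - T.card - 1) (by omega) (by omega)]
      have : m - T.card ≠ 0 := by omega
      simp [p, this]
    · simp
  have h3 := sum_choose_mul_sqrtCoeff (m := m) (by omega)
  rw [h1, h2, Finset.sum_range_succ] at key
  rw [Finset.sum_range_succ] at h3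
  have h4 : ∑ i ∈ Finset.range m, (m.choose i : ℤ) *
      (factorCriticalNumber (i + 1) * sqrtCoeff (m - i)) =
      ∑ i ∈ Finset.range m, (m.choose i : ℤ) * (factorCriticalNumber (i + 1) * p (m - i)) +
      m * ∑ i ∈ Finset.range m, ((m - 1).choose i : ℤ) *
        (factorCriticalNumber (i + 1) * factorCriticalNumber (m - 1 - i)) := by
    rw [Finset.mul_sum, ← Finset.sum_add_distrib]
    refine Finset.sum_congr rfl fun i hi => ?_
    obtain ⟨l, hl⟩ : ∃ l, m = i + l + 1 := ⟨m - i - 1, by have := Finset.mem_range.1 hi; omega⟩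
    rw [hl, show i + l + 1 - i = l + 1 by omega, show i + l + 1 - 1 - i = l by omega,
      show i + l + 1 - 1 = i + l by omega]
    -- Absorption turns the double-deficiency term into (l + 1) f(l); together with `p (l + 1)` =
    -- -f(l) this is l f(l), the coefficient of √(1 + x²).
    have hch : ((i + l + 1 : ℕ) : ℤ) * (i + l).choose i = (l + 1) * (i + l + 1).choose i := by
      have := Nat.add_one_mul_choose_eq (i + l) l
      rw [show (i + l).choose l = (i + l).choose i from Nat.choose_symm_add.symm,
        show (i + l + 1).choose (l + 1) = (i + l + 1).choose i from
          (Nat.choose_symm_add (a := i) (b := l + 1)).symm] at this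
      rw [mul_comm (l + 1 : ℤ)]
      exact_mod_cast this
    have hp : p (l + 1) = - factorCriticalNumber l := by simp [p]
    rw [hp, sqrtCoeff, ← mul_assoc _ (((i + l).choose i : ℕ) : ℤ), hch]
    ring
  simp only [p, Nat.sub_self, sqrtCoeff, if_true] at h3 h4 key ⊢
  linarith

theorem inessentialSum_eq_blockNumber (s : Finset α) (j : ℕ) :
    inessentialSum s j = blockNumber j s.card := by
  induction j generalizing s with
  | zero => simp [inessentialSum_zero, blockNumber]
  | succ j ih =>
    rcases s.eq_empty_or_nonempty with rfl | ⟨v, hv⟩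
    · simp [inessentialSum_empty_succ, blockNumber]
    · rw [← Finset.insert_erase hv, inessentialSum_insert_succ (Finset.notMem_erase v s),
        Finset.card_insert_of_notMem (Finset.notMem_erase v s), blockNumber]
      simp only [← nsmul_eq_mul]
      rw [← Finset.sum_powerset_apply_card (f := fun i =>
        factorCriticalNumber (i + 1) * blockNumber j ((s.erase v).card - i))]
      refine Finset.sum_congr rfl fun T hT => ?_
      rw [Finset.mem_powerset] at hT
      rw [inessentialSum_one, ih, Finset.card_sdiff_of_subset hT,
        Finset.card_insert_of_notMem fun h => by simpa using hT h]

end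

/-! ### Set partitions and the block recursion. -/

section Partition

variable {α : Type*} [DecidableEq α] {s T : Finset α} {v : α}

/-- Deleting the block `T` of `v` is a bijection onto the partitions of `s \ T`, inverted by
`Finpartition.extend`. -/
theorem sum_finpartition_part_eq (w : ℕ → ℤ) (hv : v ∈ s) (hT : T ⊆ s) (hvT : v ∈ T) (j : ℕ) :
    ∑ τ : Finpartition s with τ.parts.card = j + 1 ∧ τ.part v = T, ∏ B ∈ τ.parts, w B.card =
      w T.card * ∑ τ : Finpartition (s \ T) with τ.parts.card = j, ∏ B ∈ τ.parts, w B.card := by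
  have hT0 : T ≠ ⊥ := fun h => by simp [h] at hvT
  have hdisj : Disjoint (s \ T) T := Finset.sdiff_disjoint
  have hsup : (s \ T) ⊔ T = s := Finset.sdiff_union_of_subset hT
  have hnot (τ : Finpartition (s \ T)) : T ∉ τ.parts := fun h => by
    have := τ.le h hvT
    simp [hvT] at this
  rw [Finset.mul_sum]
  refine (Finset.sum_bij (fun τ _ => τ.extend hT0 hdisj hsup) ?_ ?_ ?_ ?_).symm
  · intro τ hτ
    simp only [Finset.mem_filter, Finset.mem_univ, true_and] at hτ ⊢
    refine ⟨by rw [Finpartition.card_extend, hτ], ?_⟩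
    exact Finpartition.part_eq_of_mem _ (by simp [Finpartition.extend]) hvT
  · intro τ _ τ' _ h
    ext1
    have := congrArg (fun σ => σ.parts.erase T) h
    simpa [Finpartition.extend, Finset.erase_insert, hnot] using this
  · intro σ hσ
    simp only [Finset.mem_filter, Finset.mem_univ, true_and] at hσ
    have hTσ : T ∈ σ.parts := by
      rw [← hσ.2]
      simpa using hv
    have hsup' : (σ.parts.erase T).sup id = s \ T := by
      ext x
      simp only [Finset.mem_sup, Finset.mem_erase, id, Finset.mem_sdiff]
      constructor
      · rintro ⟨B, ⟨hne, hB⟩, hx⟩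
        exact ⟨σ.le hB hx, fun hxT => hne (σ.eq_of_mem_parts hB hTσ hx hxT)⟩
      · rintro ⟨hx, hxT⟩
        obtain ⟨B, hB, hxB⟩ := σ.exists_mem hx
        exact ⟨B, ⟨by rintro rfl; exact hxT hxB, hB⟩, hxB⟩
    refine ⟨σ.ofSubset (Finset.erase_subset T _) hsup', ?_, ?_⟩
    · simp only [Finset.mem_filter, Finset.mem_univ, true_and, Finpartition.ofSubset]
      rw [Finset.card_erase_of_mem hTσ, hσ.1, Nat.add_sub_cancel]
    · ext1
      simp [Finpartition.extend, Finpartition.ofSubset, Finset.insert_erase hTσ]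
  · intro τ _
    simp only [Finpartition.extend]
    rw [Finset.prod_insert (hnot τ)]

theorem sum_finpartition_insert (w : ℕ → ℤ) (hv : v ∉ s) (j : ℕ) :
    ∑ τ : Finpartition (insert v s) with τ.parts.card = j + 1, ∏ B ∈ τ.parts, w B.card =
      ∑ T ∈ s.powerset, w (T.card + 1) *
        ∑ τ : Finpartition (s \ T) with τ.parts.card = j, ∏ B ∈ τ.parts, w B.card := by
  rw [← Finset.sum_fiberwise_of_maps_to (g := fun τ => (τ.part v).erase v) (t := s.powerset)]
  · refine Finset.sum_congr rfl fun T hT => ?_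
    rw [Finset.mem_powerset] at hT
    have hvT : v ∉ T := fun h => hv (hT h)
    have hd : insert v s \ insert v T = s \ T := by
      ext
      simp
      grind
    have := sum_finpartition_part_eq w (Finset.mem_insert_self v s)
      (Finset.insert_subset_insert v hT) (Finset.mem_insert_self v T) j
    rw [Finset.card_insert_of_notMem hvT, hd] at this
    rw [← this, Finset.filter_filter]
    congr 1
    ext τ
    have hmem : v ∈ τ.part v := by simp
    simp only [Finset.mem_filter, Finset.mem_univ, true_and]
    refine and_congr_right fun _ => ⟨fun h => ?_, fun h => ?_⟩
    · rw [← h, Finset.insert_erase hmem]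
    · rw [h, Finset.erase_insert hvT]
  · intro τ _
    rw [Finset.mem_powerset]
    intro x hx
    rw [Finset.mem_erase] at hx
    have := τ.part_subset v hx.2
    grind

theorem sum_finpartition_eq_blockNumber (s : Finset α) (j : ℕ) :
    ∑ τ : Finpartition s with τ.parts.card = j, ∏ B ∈ τ.parts, factorCriticalNumber B.card =
      blockNumber j s.card := by
  induction j generalizing s with
  | zero =>
    rcases s.eq_empty_or_nonempty with rfl | ⟨v, hv⟩
    · have h : ∀ τ : Finpartition (∅ : Finset α), τ.parts = ∅ := fun τ =>
        Finpartition.parts_eq_empty_iff.2 rfl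
      have : Unique (Finpartition (∅ : Finset α)) := inferInstanceAs (Unique (Finpartition ⊥))
      rw [Finset.filter_true_of_mem (by simp [h]), Finset.univ_unique, Finset.sum_singleton, h]
      simp [blockNumber]
    · rw [Finset.filter_false_of_mem, Finset.sum_empty, blockNumber, if_neg]
      · exact (Finset.card_pos.2 ⟨v, hv⟩).ne'
      · intro τ _ h
        obtain ⟨B, hB, -⟩ := τ.exists_mem hv
        simp [Finset.card_eq_zero.1 h] at hB
  | succ j ih =>
    rcases s.eq_empty_or_nonempty with rfl | ⟨v, hv⟩
    · rw [Finset.filter_false_of_mem, Finset.sum_empty, Finset.card_empty, blockNumber]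
      intro τ _ h
      obtain ⟨B, hB⟩ := Finset.card_pos.1 (by omega : 0 < τ.parts.card)
      exact τ.ne_bot hB (Finset.subset_empty.1 (τ.le hB))
    · rw [← Finset.insert_erase hv, sum_finpartition_insert _ (Finset.notMem_erase v s),
        Finset.card_insert_of_notMem (Finset.notMem_erase v s), blockNumber]
      simp only [← nsmul_eq_mul]
      rw [← Finset.sum_powerset_apply_card (f := fun i =>
        factorCriticalNumber (i + 1) * blockNumber j ((s.erase v).card - i))]
      refine Finset.sum_congr rfl fun T hT => ?_
      rw [ih, Finset.card_sdiff_of_subset (Finset.mem_powerset.1 hT)]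

/-- The sign exponents (|B| - 1)/2 add up to half of |s| minus the number of blocks, which is `m`.
-/
theorem prod_factorCriticalNumber_of_odd (τ : Finpartition s) (h : ∀ B ∈ τ.parts, Odd B.card)
    {m : ℕ} (hm : τ.parts.card + 2 * m = s.card) :
    ∏ B ∈ τ.parts, factorCriticalNumber B.card =
      (-1) ^ m * ((∏ B ∈ τ.parts, (B.card - 2)‼ : ℕ) : ℤ) ^ 2 := by
  have h1 : ∑ B ∈ τ.parts, (B.card - 1) / 2 = m := by
    have h2 : 2 * ∑ B ∈ τ.parts, (B.card - 1) / 2 + τ.parts.card = s.card := by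
      rw [← τ.sum_card_parts, Finset.card_eq_sum_ones, Finset.mul_sum, ← Finset.sum_add_distrib]
      refine Finset.sum_congr rfl fun B hB => ?_
      obtain ⟨k, hk⟩ := h B hB
      omega
    omega
  rw [← h1, ← Finset.prod_pow_eq_pow_sum, Nat.cast_prod, ← Finset.prod_pow,
    ← Finset.prod_mul_distrib]
  exact Finset.prod_congr rfl fun B hB => if_pos (h B hB)

theorem sum_odd_finpartition (s : Finset α) {j m : ℕ} (hm : j + 2 * m = s.card) :
    (-1) ^ m * ∑ τ : Finpartition s with τ.parts.card = j ∧ ∀ B ∈ τ.parts, Odd B.card,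
      ((∏ B ∈ τ.parts, (B.card - 2)‼ : ℕ) : ℤ) ^ 2 = blockNumber j s.card := by
  rw [← sum_finpartition_eq_blockNumber, Finset.mul_sum, ← Finset.filter_filter]
  rw [Finset.sum_filter]
  refine Finset.sum_congr rfl fun τ hτ => ?_
  simp only [Finset.mem_filter, Finset.mem_univ, true_and] at hτ
  split_ifs with h
  · rw [prod_factorCriticalNumber_of_odd τ h (hτ ▸ hm)]
  · push Not at h
    obtain ⟨B, hB, hodd⟩ := h
    rw [Finset.prod_eq_zero hB]
    exact if_neg hodd

end Partition

/-! ### Translation between simple graphs and edge sets. -/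

section Translation

variable {V : Type*} [DecidableEq V] {G : SimpleGraph V} {E : Finset (Sym2 V)}

/-- Stated for every `X` closed under partners in `M`, so that the induction can remove one matched
pair at a time while counting the edges inside `X`. -/
theorem SimpleGraph.Subgraph.IsMatching.matchable {M : G.Subgraph} (hM : M.IsMatching)
    (hE : M.edgeSet ⊆ E) {F : Finset (Sym2 V)} (hF : (F : Set (Sym2 V)) = M.edgeSet)
    (X : Finset V) (hX : (X : Set V) ⊆ M.verts) (hclosed : ∀ x ∈ X, ∀ y, M.Adj x y → y ∈ X) :
    Matchable E X ∧ X.card = 2 * (F ∩ completeEdges X).card := by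
  induction hn : X.card using Nat.strong_induction_on generalizing X with
  | _ n ih =>
  rcases X.eq_empty_or_nonempty with rfl | ⟨x, hx⟩
  · have : completeEdges (∅ : Finset V) = ∅ := by simp [completeEdges]
    simp [Matchable.empty, this, ← hn]
  obtain ⟨y, hxy, huniq⟩ := hM (hX hx)
  have hne : x ≠ y := M.adj_sub hxy |>.ne
  have hy := hclosed x hx y hxy
  have huniq' : ∀ z, M.Adj y z → z = x := by
    obtain ⟨x', -, h⟩ := hM (hX hy)
    intro z hz
    rw [h z hz, h x hxy.symm]
  have hyX : y ∈ X.erase x := by simp [hne.symm, hy]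
  have h1 := Finset.card_erase_add_one hyX
  have h2 := Finset.card_erase_add_one hx
  obtain ⟨h3, h4⟩ := ih _ (by omega) ((X.erase x).erase y)
    (fun z hz => hX (Finset.mem_of_mem_erase (Finset.mem_of_mem_erase (Finset.mem_coe.1 hz))))
    (fun z hz w hzw => by
      simp only [Finset.mem_erase] at hz ⊢
      refine ⟨?_, ?_, hclosed z hz.2.2 w hzw⟩
      · rintro rfl
        exact hz.2.1 (huniq' z hzw.symm)
      · rintro rfl
        exact hz.1 (huniq z hzw.symm)) rfl
  refine ⟨.of_erase (by exact_mod_cast hE hxy) hne hx hy h3, ?_⟩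
  have h5 : F ∩ completeEdges X = insert s(x, y) (F ∩ completeEdges ((X.erase x).erase y)) := by
    have hmem (e : Sym2 V) : e ∈ F ↔ e ∈ M.edgeSet := by rw [← hF]; simp
    ext e
    induction e with
    | _ a b =>
    simp only [Finset.mem_inter, Finset.mem_insert, hmem, SimpleGraph.Subgraph.mem_edgeSet,
      mk_mem_completeEdges, Finset.mem_erase, Sym2.eq_iff]
    constructor
    · rintro ⟨hab, ⟨ha, hb⟩, hne'⟩
      by_cases hax : a = x
      · subst hax
        exact .inl (.inl ⟨rfl, huniq b hab⟩)
      by_cases hbx : b = x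
      · subst hbx
        exact .inl (.inr ⟨huniq a hab.symm, rfl⟩)
      have hay : a ≠ y := by
        rintro rfl
        exact hbx (huniq' b hab)
      have hby : b ≠ y := by
        rintro rfl
        exact hax (huniq' a hab.symm)
      exact .inr ⟨hab, ⟨⟨hay, hax, ha⟩, hby, hbx, hb⟩, hne'⟩
    · rintro ((⟨rfl, rfl⟩ | ⟨rfl, rfl⟩) | ⟨hab, ⟨ha, hb⟩, hne'⟩)
      · exact ⟨hxy, ⟨hx, hy⟩, hne⟩
      · exact ⟨hxy.symm, ⟨hy, hx⟩, hne.symm⟩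
      · exact ⟨hab, ⟨ha.2.2, hb.2.2⟩, hne'⟩
  rw [h5, Finset.card_insert_of_notMem (by simp)]
  omega

theorem Matchable.exists_isMatching (hE : (E : Set (Sym2 V)) ⊆ G.edgeSet) {X : Finset V}
    (h : Matchable E X) : ∃ M : G.Subgraph, M.IsMatching ∧ M.verts = X := by
  induction h with
  | empty => exact ⟨⊥, fun v hv => by simp at hv, by simp⟩
  | @insert_pair x y X hxy hne hx hy hX ih =>
    obtain ⟨M, hM, hMX⟩ := ih
    have hadj : G.Adj x y := hE hxy
    refine ⟨G.subgraphOfAdj hadj ⊔ M, .sup (.subgraphOfAdj hadj) hM ?_, ?_⟩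
    · rw [hM.support_eq_verts, (SimpleGraph.Subgraph.IsMatching.subgraphOfAdj hadj).support_eq_verts,
        hMX, Set.disjoint_left]
      simp
      grind
    · simp [hMX, Set.insert_union]

variable [Fintype V]

theorem SimpleGraph.Subgraph.IsMatching.matchable_toFinset {M : G.Subgraph} (hM : M.IsMatching)
    (hE : M.edgeSet ⊆ E) {X : Finset V} (hX : (X : Set V) = M.verts) :
    Matchable E X ∧ X.card = 2 * M.edgeSet.ncard := by
  classical
  have h := hM.matchable hE (F := M.edgeSet.toFinset) (by simp) X hX.le
    (fun x _ y hxy => by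
      rw [← Finset.mem_coe, hX]
      exact hxy.snd_mem)
  refine ⟨h.1, ?_⟩
  rw [h.2, Set.ncard_eq_toFinset_card', Finset.inter_eq_left.2]
  intro e
  induction e with
  | _ x y =>
  rw [Set.mem_toFinset, SimpleGraph.Subgraph.mem_edgeSet, mk_mem_completeEdges]
  intro h
  have hmem {z : V} (hz : z ∈ M.verts) : z ∈ X := by rwa [← Finset.mem_coe, hX]
  exact ⟨⟨hmem h.fst_mem, hmem h.snd_mem⟩, (M.adj_sub h).ne⟩

theorem hasMatchingOfSize_iff (hE : (E : Set (Sym2 V)) = G.edgeSet) {k : ℕ} :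
    HasMatchingOfSize G k ↔ ∃ X, Matchable E X ∧ X.card = 2 * k := by
  classical
  constructor
  · rintro ⟨M, hM, hk⟩
    have := hM.matchable_toFinset (E := E) (hE ▸ M.edgeSet_subset) (X := M.verts.toFinset) (by simp)
    exact ⟨_, this.1, by rw [this.2, hk]⟩
  · rintro ⟨X, hX, hk⟩
    obtain ⟨M, hM, hMX⟩ := hX.exists_isMatching hE.le
    have := (hM.matchable_toFinset (E := E) (hE ▸ M.edgeSet_subset) hMX.symm).2
    exact ⟨M, hM, by omega⟩

theorem hasPerfectMatching_iff (hE : (E : Set (Sym2 V)) = G.edgeSet) :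
    HasPerfectMatching G ↔ Matchable E Finset.univ := by
  constructor
  · rintro ⟨M, hM, hs⟩
    refine (hM.matchable_toFinset (E := E) (hE ▸ M.edgeSet_subset) (X := Finset.univ) ?_).1
    rw [Finset.coe_univ, hs.verts_eq_univ]
  · intro h
    obtain ⟨M, hM, hMX⟩ := h.exists_isMatching hE.le
    exact ⟨M, hM, fun v => by simp [hMX]⟩

theorem sum_simpleGraph_eq_signedSum {P : SimpleGraph V → Prop} [DecidablePred P]
    {Q : Finset (Sym2 V) → Prop}
    (h : ∀ (G : SimpleGraph V) (E : Finset (Sym2 V)), (E : Set (Sym2 V)) = G.edgeSet →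
      (P G ↔ Q E)) :
    ∑ G : SimpleGraph V with P G, (-1 : ℤ) ^ numEdges G =
      signedSum (completeEdges (Finset.univ : Finset V)) Q := by
  classical
  rw [Finset.sum_filter, signedSum]
  refine Finset.sum_bij' (fun G _ => G.edgeSet.toFinset)
    (fun E _ => SimpleGraph.fromEdgeSet (E : Set (Sym2 V))) ?_ ?_ ?_ ?_ ?_
  · intro G _
    rw [Finset.mem_powerset]
    intro e
    induction e with
    | _ x y =>
    simp only [Set.mem_toFinset, SimpleGraph.mem_edgeSet, mk_mem_completeEdges]
    exact fun h => by simp [h.ne]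
  · simp
  · intro G _
    simp
  · intro E hE
    rw [Finset.mem_powerset] at hE
    ext e
    have h : e ∈ E → ¬ e.IsDiag := fun h => (Finset.mem_filter.1 (hE h)).2
    simp
    exact h
  · intro G _
    have := h G G.edgeSet.toFinset (by simp)
    rw [numEdges, Set.ncard_eq_toFinset_card']
    by_cases hP : P G
    · rw [if_pos hP, if_pos (this.1 hP)]
    · rw [if_neg hP, if_neg fun hQ => hP (this.2 hQ)]

end Translation

/-! ### Conclusion. -/

/-- The signed sum over the graphs without a matching of size `m + 1`. -/
theorem sum_noMatchingGraphs (n m : ℕ) (h : n = 0 → m = 0) :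
    ∑ G ∈ noMatchingGraphs (m + 1) (n + 1), (-1 : ℤ) ^ numEdges G =
      if 2 * m ≤ n then blockNumber (n - 2 * m) n else 0 := by
  classical
  have hc : ((Finset.univ : Finset (Fin (n + 1))).erase 0).card = n := by simp
  have key := signedSum_no_matching (Finset.notMem_erase 0 (Finset.univ : Finset (Fin (n + 1)))) m
    (by
      rcases n with _ | n
      · exact .inr (h rfl)
      · exact .inl (Finset.card_pos.1 (by omega)))
  rw [Finset.insert_erase (Finset.mem_univ _), hc, inessentialSum_eq_blockNumber, hc] at key
  rw [← key, noMatchingGraphs]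
  exact sum_simpleGraph_eq_signedSum (V := Fin (n + 1))
    fun G E hE => not_congr (hasMatchingOfSize_iff hE (k := m + 1))

theorem noPerfectMatchingGraphs_eq (k : ℕ) :
    noPerfectMatchingGraphs k = noMatchingGraphs k (2 * k) := by
  classical
  rw [noPerfectMatchingGraphs, noMatchingGraphs]
  refine Finset.filter_congr fun G _ => not_congr ?_
  have hE : ((G.edgeSet.toFinset : Finset (Sym2 (Fin (2 * k)))) : Set (Sym2 (Fin (2 * k)))) =
    G.edgeSet := by simp
  rw [hasPerfectMatching_iff hE, hasMatchingOfSize_iff hE]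
  constructor
  · exact fun h => ⟨_, h, by simp⟩
  · rintro ⟨X, hX, hc⟩
    rwa [Finset.eq_univ_of_card X (by simp [hc])] at hX

theorem corollary3 :
    (∀ n k : ℕ, 1 ≤ n → 1 ≤ k → (n = 1 → k = 1) →
      ∑ G ∈ noMatchingGraphs k n, (-1 : ℤ) ^ numEdges G =
        (-1 : ℤ) ^ (k - 1) *
          ∑ τ ∈ oddPartitions n k, ((∏ B ∈ τ.parts, (B.card - 2)‼ : ℕ) : ℤ) ^ 2) ∧
    (∀ k : ℕ, 1 ≤ k →
      ∑ G ∈ noPerfectMatchingGraphs k, (-1 : ℤ) ^ numEdges G =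
        (-1 : ℤ) ^ (k - 1) * (((2 * k - 3)‼ : ℕ) : ℤ) ^ 2) := by
  constructor
  · intro n k hn hk hnk
    obtain ⟨n, rfl⟩ := Nat.exists_eq_add_of_le' hn
    obtain ⟨k, rfl⟩ := Nat.exists_eq_add_of_le' hk
    rw [sum_noMatchingGraphs n k (by omega), Nat.add_sub_cancel, oddPartitions]
    split_ifs with h
    · have := sum_odd_finpartition (Finset.univ : Finset (Fin (n + 1 - 1))) (j := n - 2 * k)
        (m := k) (by simp; omega)
      rw [Finset.card_univ, Fintype.card_fin, Nat.add_sub_cancel] at this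
      rw [← this]
      congr 1
      refine Finset.sum_congr ?_ fun _ _ => rfl
      ext τ
      simp only [Finset.mem_filter, Finset.mem_univ, true_and]
      refine and_congr_left fun _ => ?_
      omega
    · rw [Finset.filter_false_of_mem, Finset.sum_empty, mul_zero]
      rintro τ _ ⟨h', -⟩
      omega
  · intro k hk
    obtain ⟨k, rfl⟩ := Nat.exists_eq_add_of_le' hk
    have h := sum_noMatchingGraphs (2 * k + 1) k (by omega)
    rw [if_pos (by omega), show 2 * k + 1 - 2 * k = 1 by omega] at h
    have h' : blockNumber 1 (2 * k + 1) = factorCriticalNumber (2 * k + 1) := by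
      have := inessentialSum_eq_blockNumber (Finset.univ : Finset (Fin (2 * k + 1))) 1
      rw [inessentialSum_one] at this
      simpa using this.symm
    rw [noPerfectMatchingGraphs_eq]
    refine h.trans ?_
    rw [h', factorCriticalNumber, if_pos ⟨k, rfl⟩]
    congr 2
    omega
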